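/- **Conventions.** Spaces have base points, maps and homotopies preserve base points, $[X,Y]$ is the set of homotopy classes of maps, and $0\in[X,Y]$ is the class of the constant map. A space is *well-pointed* if its base point is closed and the inclusion of the base point has the homotopy extension property (for example, every CW complex). $\Omega X$ is the based loop space with concatenation $\cdot$ as its product, $\Sigma X$ the reduced suspension, $X\wedge Y$ the smash product, and $\mathrm{ad}:[\Sigma A,X]\to[A,\Omega X]$ the adjunction bijection. A *Samelson map* of $X$ is a map $S:\Omega X\wedge\Omega X\to\Omega X$ whose composite with the quotient map $\Omega X\times\Omega X\to\Omega X\wedge\Omega X$ is homotopic to the commutator map $(a,b)\mapsto a\cdot b\cdot a^{-1}\cdot b^{-1}$. The *generalized Whitehead product* of $\alpha\in[\Sigma A,X]$ and $\beta\in[\Sigma A',X]$ is $[\alpha,\beta]=\mathrm{ad}^{-1}\bigl(S\circ(\mathrm{ad}\,\alpha\wedge\mathrm{ad}\,\beta)\bigr)\in[\Sigma(A\wedge A'),X]$. **Theorem.** Let $F$, $E$, $B$ be well-pointed spaces, $p:E\to B$ a (Hurewicz) fibration, $i:F\to E$ the inclusion of its fibre over the base point (more generally, a homotopy equivalence from $F$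 to that fibre followed by the inclusion), and $s:B\to E$ a homotopy section, that is, a map with $p\circ s\simeq \mathrm{id}_B$. 1. For all well-pointed spaces $X,Y$ and all $f\in[\Sigma X,B]$, $g\in[\Sigma Y,F]$ there is exactly one $\{f,g\}_s\in[\Sigma(X\wedge Y),F]$ with $i_*\{f,g\}_s=[s_*f,i_*g]$. This defines the generalized brace product $\{\,,\}_s:[\Sigma X,B]\times[\Sigma Y,F]\to[\Sigma(X\wedge Y),F]$. 2. $\{f,g\}_s=0$ for all well-pointed $X,Y$ and all $f,g$ as in 1 if and only if $$\varphi_s=\Omega s\cdot\Omega i:\Omega B\times\Omega F\to\Omega E,\qquad (\omega,\eta)\mapsto (s\circ\omega)\cdot(i\circ\eta),$$ is an $H$-map, that is, $\varphi_s(x\cdot y)\simeq\varphi_s(x)\cdot\varphi_s(y)$ as maps of $(x,y)\in(\Omega B\times\Omega F)^2$, where $\Omega B\times\Omega F$ has the componentwise product. 3. $\varphi_s$ is an $H$-map if and only if it is an $H$-splitting, that is, an $H$-map and a homotopy equivalence. 4. If $\{\,,\}_s$ vanishes on $[\Sigma X_0,B]\times[\Sigma Y_0,F]$ for a single pair of well-pointed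 spaces $X_0\simeq\Omega B$ and $Y_0\simeq\Omega F$, then $\varphi_s$ is an $H$-map. (So in 2 the spaces $X,Y$ may be restricted to any class of well-pointed spaces that contains, up to homotopy equivalence, $\Omega B$ and $\Omega F$.) -/

import Mathlib

open scoped unitInterval

universe u

/-- A topological space with a base point. -/
structure PointedSpace : Type (u + 1) where
  carrier : Type u
  [top : TopologicalSpace carrier]
  pt : carrier

namespace PointedSpace

instance : CoeSort PointedSpace.{u} (Type u) := ⟨PointedSpace.carrier⟩

instance (X : PointedSpace.{u}) : TopologicalSpace X := X.top

/-- The base point is closed and its inclusion has the homotopy extension property.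
Every CW complex is well-pointed at each of its points. -/
def WellPointed (X : PointedSpace.{u}) : Prop :=
  IsClosed ({X.pt} : Set X) ∧
    ∀ (Z : Type u) [TopologicalSpace Z] (f : C(X, Z)) (γ : C(I, Z)), γ 0 = f X.pt →
      ∃ H : C(I × X, Z), (∀ x, H (0, x) = f x) ∧ ∀ t, H (t, X.pt) = γ t

end PointedSpace

/-- Base point preserving continuous maps. -/
structure PointedMap (X Y : PointedSpace.{u}) where
  toMap : C(X, Y)
  map_pt : toMap X.pt = Y.pt

namespace PointedMap

variable {X Y Z : PointedSpace.{u}}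

protected def id (X : PointedSpace.{u}) : PointedMap X X := ⟨ContinuousMap.id X, rfl⟩

protected def comp (g : PointedMap Y Z) (f : PointedMap X Y) : PointedMap X Z :=
  ⟨g.toMap.comp f.toMap, by simp [f.map_pt, g.map_pt]⟩

/-- The constant map at the base point. -/
protected def const (X Y : PointedSpace.{u}) : PointedMap X Y := ⟨ContinuousMap.const X Y.pt, rfl⟩

/-- Homotopy through base point preserving maps. -/
def Homotopic (f g : PointedMap X Y) : Prop :=
  f.toMap.HomotopicRel g.toMap {X.pt}

theorem homotopic_equivalence : Equivalence (Homotopic (X := X) (Y := Y)) :=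
  ⟨fun f => .refl f.toMap, fun h => h.symm, fun h k => h.trans k⟩

instance homotopySetoid (X Y : PointedSpace.{u}) : Setoid (PointedMap X Y) :=
  ⟨Homotopic, homotopic_equivalence⟩

theorem Homotopic.postcomp {f f' : PointedMap X Y} (h : f.Homotopic f') (g : PointedMap Y Z) :
    (g.comp f).Homotopic (g.comp f') :=
  h.comp_continuousMap g.toMap

/-- A family of maps `I × X → Y` that is constant at the base point is a pointed homotopy. -/
theorem Homotopic.of_family {f g : PointedMap X Y} (H : I × X → Y) (hH : Continuous H)
    (h0 : ∀ x, H (0, x) = f.toMap x) (h1 : ∀ x, H (1, x) = g.toMap x)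
    (hpt : ∀ t, H (t, X.pt) = Y.pt) : f.Homotopic g :=
  ⟨{ toFun := H
     continuous_toFun := hH
     map_zero_left := h0
     map_one_left := h1
     prop' := by
      rintro t x rfl
      exact (hpt t).trans f.map_pt.symm }⟩

theorem Homotopic.exists_family {f g : PointedMap X Y} (h : f.Homotopic g) :
    ∃ H : I × X → Y, Continuous H ∧ (∀ x, H (0, x) = f.toMap x) ∧
      (∀ x, H (1, x) = g.toMap x) ∧ ∀ t, H (t, X.pt) = Y.pt := by
  obtain ⟨H⟩ := h
  exact ⟨H, H.continuous, H.apply_zero, H.apply_one,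
    fun t => (H.eq_fst t rfl).trans f.map_pt⟩

/-- Pointed homotopy equivalences. -/
def IsHomotopyEquiv (f : PointedMap X Y) : Prop :=
  ∃ g : PointedMap Y X, (g.comp f).Homotopic (PointedMap.id X) ∧ (f.comp g).Homotopic (PointedMap.id Y)

end PointedMap

/-- The set `[X, Y]` of pointed homotopy classes. -/
def HomotopyClass (X Y : PointedSpace.{u}) : Type u :=
  Quotient (PointedMap.homotopySetoid X Y)

namespace HomotopyClass

variable {X Y Z : PointedSpace.{u}}

def mk (f : PointedMap X Y) : HomotopyClass X Y := Quotient.mk _ f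

/-- The class of the constant map. -/
instance : Zero (HomotopyClass X Y) := ⟨mk (PointedMap.const X Y)⟩

/-- `g_* : [X, Y] → [X, Z]`. -/
def push (g : PointedMap Y Z) : HomotopyClass X Y → HomotopyClass X Z :=
  Quotient.map (fun f => g.comp f) fun _ _ h => PointedMap.Homotopic.postcomp h g

end HomotopyClass

/-- The equivalence relation that identifies all points of `A`. -/
def collapseSetoid {Z : Type u} (A : Set Z) : Setoid Z where
  r z w := z = w ∨ (z ∈ A ∧ w ∈ A)
  iseqv := ⟨fun _ => Or.inl rfl,
    by rintro z w (rfl | ⟨hz, hw⟩) <;> [exact Or.inl rfl; exact Or.inr ⟨hw, hz⟩],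
    by
      rintro z w v (rfl | ⟨hz, hw⟩) (rfl | ⟨hw', hv⟩)
      · exact Or.inl rfl
      · exact Or.inr ⟨hw', hv⟩
      · exact Or.inr ⟨hz, hw⟩
      · exact Or.inr ⟨hz, hv⟩⟩

namespace PointedSpace

/-- `X × Y` with base point `(x₀, y₀)`. -/
protected def prod (X Y : PointedSpace.{u}) : PointedSpace.{u} := ⟨X × Y, (X.pt, Y.pt)⟩

/-- The wedge `X ∨ Y`, as the subset `X × {y₀} ∪ {x₀} × Y` of `X × Y`. -/
def wedgeSet (X Y : PointedSpace.{u}) : Set (X × Y) := {z | z.1 = X.pt ∨ z.2 = Y.pt}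

/-- The smash product `X ∧ Y = (X × Y) / (X ∨ Y)`. -/
def smash (X Y : PointedSpace.{u}) : PointedSpace.{u} :=
  ⟨Quotient (collapseSetoid (wedgeSet X Y)), Quotient.mk _ (X.pt, Y.pt)⟩

/-- The subset `X × {0, 1} ∪ {x₀} × I` of `X × I`. -/
def suspSet (X : PointedSpace.{u}) : Set (X × I) := {z | z.1 = X.pt ∨ z.2 = 0 ∨ z.2 = 1}

/-- The reduced suspension `ΣX = (X × I) / (X × {0, 1} ∪ {x₀} × I)`. -/
def susp (X : PointedSpace.{u}) : PointedSpace.{u} :=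
  ⟨Quotient (collapseSetoid (suspSet X)), Quotient.mk _ (X.pt, 0)⟩

/-- The based loop space `ΩX` with the compact-open topology. -/
def loop (X : PointedSpace.{u}) : PointedSpace.{u} := ⟨Path X.pt X.pt, Path.refl X.pt⟩

/-- The fibre of a pointed map over the base point. -/
def fibre {E B : PointedSpace.{u}} (p : PointedMap E B) : PointedSpace.{u} :=
  ⟨{e : E // p.toMap e = B.pt}, ⟨E.pt, p.map_pt⟩⟩

/-- Mathlib's H-space structure on a loop space: the product is concatenation of loops. -/
noncomputable instance (X : PointedSpace.{u}) : HSpace (loop X) :=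
  inferInstanceAs (HSpace (Path X.pt X.pt))

/-- Mathlib's componentwise H-space structure on a product. -/
instance (X Y : PointedSpace.{u}) [HSpace X] [HSpace Y] : HSpace (PointedSpace.prod X Y) :=
  inferInstanceAs (HSpace (X × Y))

/-- The point of `X ∧ Y` given by `x ∈ X` and `y ∈ Y`. -/
def smashMk {X Y : PointedSpace.{u}} (z : X × Y) : smash X Y := Quotient.mk _ z

/-- The point of `ΣX` given by `x ∈ X` and `t ∈ I`. -/
def suspMk {X : PointedSpace.{u}} (z : X × I) : susp X := Quotient.mk _ z

theorem isQuotientMap_smashMk {X Y : PointedSpace.{u}} :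
    Topology.IsQuotientMap (smashMk (X := X) (Y := Y)) := isQuotientMap_quotient_mk'

theorem isQuotientMap_suspMk {X : PointedSpace.{u}} :
    Topology.IsQuotientMap (suspMk (X := X)) := isQuotientMap_quotient_mk'

theorem smashMk_eq_pt {X Y : PointedSpace.{u}} {z : X × Y} (hz : z ∈ wedgeSet X Y) :
    smashMk z = (smash X Y).pt := Quotient.sound (Or.inr ⟨hz, Or.inl rfl⟩)

theorem suspMk_eq_pt {X : PointedSpace.{u}} {z : X × I} (hz : z ∈ suspSet X) :
    suspMk z = (susp X).pt := Quotient.sound (Or.inr ⟨hz, Or.inl rfl⟩)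

end PointedSpace

section Products

open PointedSpace

namespace PointedMap

variable {A A' B B' X Y : PointedSpace.{u}}

/-- The quotient map `X × Y → X ∧ Y`. -/
def smashQuot (X Y : PointedSpace.{u}) : PointedMap (PointedSpace.prod X Y) (smash X Y) :=
  ⟨⟨smashMk, isQuotientMap_smashMk.continuous⟩, rfl⟩

/-- The map `f ∧ g : A ∧ B → A' ∧ B'`. -/
def smashMap (f : PointedMap A A') (g : PointedMap B B') :
    PointedMap (smash A B) (smash A' B') where
  toMap :=
    { toFun := Quotient.lift (fun z : A × B => smashMk (f.toMap z.1, g.toMap z.2)) (by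
        rintro z w (rfl | ⟨hz, hw⟩)
        · rfl
        · have key : ∀ z ∈ wedgeSet A B,
              smashMk (f.toMap z.1, g.toMap z.2) = (smash A' B').pt := by
            rintro z (hz | hz)
            · exact smashMk_eq_pt (Or.inl (by simp [hz, f.map_pt]))
            · exact smashMk_eq_pt (Or.inr (by simp [hz, g.map_pt]))
          rw [key z hz, key w hw])
      continuous_toFun := Continuous.quotient_lift
        (isQuotientMap_smashMk.continuous.comp (by fun_prop)) _ }
  map_pt := by
    change smashMk (f.toMap A.pt, g.toMap B.pt) = _
    rw [f.map_pt, g.map_pt]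
    rfl

theorem Homotopic.smashMap {f f' : PointedMap A A'} {g g' : PointedMap B B'}
    (hf : f.Homotopic f') (hg : g.Homotopic g') :
    (f.smashMap g).Homotopic (f'.smashMap g') := by
  obtain ⟨H, hH, H0, H1, Hpt⟩ := hf.exists_family
  obtain ⟨K, hK, K0, K1, Kpt⟩ := hg.exists_family
  have key : ∀ t, ∀ z ∈ wedgeSet A B,
      smashMk (H (t, z.1), K (t, z.2)) = (smash A' B').pt := by
    rintro t z (hz | hz)
    · exact smashMk_eq_pt (Or.inl (by simp [hz, Hpt]))
    · exact smashMk_eq_pt (Or.inr (by simp [hz, Kpt]))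
  let L : I × smash A B → smash A' B' := fun q =>
    Quotient.lift (fun z : A × B => smashMk (H (q.1, z.1), K (q.1, z.2))) (by
      rintro z w (rfl | ⟨hz, hw⟩)
      · rfl
      · exact (key q.1 z hz).trans (key q.1 w hw).symm) q.2
  refine Homotopic.of_family L ?_ ?_ ?_ ?_
  · refine isQuotientMap_smashMk.continuous_lift_prod_right ?_
    change Continuous fun q : I × (A × B) => smashMk (H (q.1, q.2.1), K (q.1, q.2.2))
    exact isQuotientMap_smashMk.continuous.comp (by fun_prop)
  · rintro ⟨z⟩
    change smashMk (H (0, z.1), K (0, z.2)) = smashMk (f.toMap z.1, g.toMap z.2)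
    rw [H0, K0]
  · rintro ⟨z⟩
    change smashMk (H (1, z.1), K (1, z.2)) = smashMk (f'.toMap z.1, g'.toMap z.2)
    rw [H1, K1]
  · intro t
    exact key t (A.pt, B.pt) (Or.inl rfl)

/-- The map `Ωf : ΩX → ΩY`, `ω ↦ f ∘ ω`. -/
def loopMap (f : PointedMap X Y) : PointedMap (loop X) (loop Y) where
  toMap :=
    { toFun := fun ω : Path X.pt X.pt =>
        (Path.map ω f.toMap.continuous).cast f.map_pt.symm f.map_pt.symm
      continuous_toFun := Path.continuous_uncurry_iff.1 (by
        change Continuous fun q : Path X.pt X.pt × I => f.toMap (q.1 q.2)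
        fun_prop) }
  map_pt := Path.ext (funext fun _ => f.map_pt)

/-- The adjoint `A → ΩX`, `a ↦ (t ↦ f [a, t])`, of `f : ΣA → X`. -/
def ad (f : PointedMap (susp A) X) : PointedMap A (loop X) where
  toMap :=
    { toFun := fun a =>
        ({ toFun := fun t => f.toMap (suspMk (a, t))
           continuous_toFun := f.toMap.continuous.comp
            (isQuotientMap_suspMk.continuous.comp (by fun_prop))
           source' := by
            rw [suspMk_eq_pt (Or.inr (Or.inl rfl)), f.map_pt]
           target' := by
            rw [suspMk_eq_pt (Or.inr (Or.inr rfl)), f.map_pt] } : Path X.pt X.pt)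
      continuous_toFun := Path.continuous_uncurry_iff.1
        (f.toMap.continuous.comp isQuotientMap_suspMk.continuous) }
  map_pt := Path.ext (funext fun _ =>
    (congrArg f.toMap (suspMk_eq_pt (Or.inl rfl))).trans f.map_pt)

theorem loop_apply_suspSet (g : PointedMap A (loop X)) {z : A × I} (hz : z ∈ suspSet A) :
    (show Path X.pt X.pt from g.toMap z.1) z.2 = X.pt := by
  rcases hz with hz | hz | hz
  · rw [hz, g.map_pt]
    rfl
  · rw [hz]
    exact Path.source _
  · rw [hz]
    exact Path.target _

/-- The adjoint `ΣA → X`, `[a, t] ↦ g(a)(t)`, of `g : A → ΩX`. -/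
def adInv (g : PointedMap A (loop X)) : PointedMap (susp A) X where
  toMap :=
    { toFun := Quotient.lift
        (fun z : A × I => (show Path X.pt X.pt from g.toMap z.1) z.2) (by
          rintro z w (rfl | ⟨hz, hw⟩)
          · rfl
          · exact (loop_apply_suspSet g hz).trans (loop_apply_suspSet g hw).symm)
      continuous_toFun := Continuous.quotient_lift
        (Path.continuous_uncurry_iff.2 g.toMap.continuous) _ }
  map_pt := loop_apply_suspSet g (z := (A.pt, 0)) (Or.inl rfl)

theorem ad_adInv (g : PointedMap A (loop X)) : ad (adInv g) = g := rfl

theorem adInv_ad (f : PointedMap (susp A) X) : adInv (ad f) = f := by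
  obtain ⟨f, hf⟩ := f
  unfold adInv
  congr 1
  ext ⟨z⟩
  rfl

theorem Homotopic.ad {f f' : PointedMap (susp A) X} (h : f.Homotopic f') :
    f.ad.Homotopic f'.ad := by
  obtain ⟨H, hH, H0, H1, Hpt⟩ := h.exists_family
  have hq : Continuous (suspMk (X := A)) := isQuotientMap_suspMk.continuous
  let K : I × A → Path X.pt X.pt := fun q =>
    { toFun := fun t => H (q.1, suspMk (q.2, t))
      continuous_toFun := by fun_prop
      source' := by rw [suspMk_eq_pt (Or.inr (Or.inl rfl)), Hpt]
      target' := by rw [suspMk_eq_pt (Or.inr (Or.inr rfl)), Hpt] }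
  refine Homotopic.of_family (Y := loop X) K (Path.continuous_uncurry_iff.1 ?_) ?_ ?_ ?_
  · change Continuous fun q : (I × A) × I => H (q.1.1, suspMk (q.1.2, q.2))
    fun_prop
  · exact fun a => Path.ext (funext fun t => H0 _)
  · exact fun a => Path.ext (funext fun t => H1 _)
  · refine fun t => Path.ext (funext fun r => ?_)
    change H (t, suspMk (A.pt, r)) = X.pt
    rw [suspMk_eq_pt (Or.inl rfl), Hpt]

theorem Homotopic.adInv {g g' : PointedMap A (loop X)} (h : g.Homotopic g') :
    g.adInv.Homotopic g'.adInv := by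
  obtain ⟨H, hH, H0, H1, Hpt⟩ := h.exists_family
  let G : I × A → Path X.pt X.pt := H
  have hG : Continuous fun q : (I × A) × I => G q.1 q.2 :=
    Path.continuous_uncurry_iff.2 hH
  have key : ∀ t, ∀ z ∈ suspSet A, G (t, z.1) z.2 = X.pt := by
    rintro t z (hz | hz | hz)
    · have : G (t, z.1) = Path.refl X.pt := by rw [hz]; exact Hpt t
      rw [this]
      rfl
    · rw [hz]
      exact Path.source _
    · rw [hz]
      exact Path.target _
  let L : I × susp A → X := fun q =>
    Quotient.lift (fun z : A × I => G (q.1, z.1) z.2) (by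
      rintro z w (rfl | ⟨hz, hw⟩)
      · rfl
      · exact (key q.1 z hz).trans (key q.1 w hw).symm) q.2
  refine Homotopic.of_family L ?_ ?_ ?_ ?_
  · refine isQuotientMap_suspMk.continuous_lift_prod_right ?_
    change Continuous fun q : I × (A × I) => G (q.1, q.2.1) q.2.2
    exact hG.comp (g := fun q : (I × A) × I => G q.1 q.2)
      (f := fun q : I × (A × I) => ((q.1, q.2.1), q.2.2)) (by fun_prop)
  · rintro ⟨z⟩
    exact congrArg (fun γ : Path X.pt X.pt => γ z.2) (H0 z.1)
  · rintro ⟨z⟩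
    exact congrArg (fun γ : Path X.pt X.pt => γ z.2) (H1 z.1)
  · intro t
    exact key t (A.pt, 0) (Or.inl rfl)

/-- The commutator map `(a, b) ↦ a · b · a⁻¹ · b⁻¹` of `ΩX`. -/
noncomputable def commutator (X : PointedSpace.{u}) : PointedMap (PointedSpace.prod (loop X) (loop X)) (loop X) where
  toMap :=
    { toFun := fun q : Path X.pt X.pt × Path X.pt X.pt =>
        ((q.1.trans q.2).trans q.1.symm).trans q.2.symm
      continuous_toFun := by
        have h1 : Continuous fun q : Path X.pt X.pt × Path X.pt X.pt => q.1.symm :=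
          Path.continuous_symm.comp continuous_fst
        have h2 : Continuous fun q : Path X.pt X.pt × Path X.pt X.pt => q.2.symm :=
          Path.continuous_symm.comp continuous_snd
        exact ((continuous_fst.path_trans continuous_snd).path_trans h1).path_trans h2 }
  map_pt := by
    change (((Path.refl X.pt).trans (Path.refl X.pt)).trans (Path.refl X.pt).symm).trans
      (Path.refl X.pt).symm = Path.refl X.pt
    simp

/-- A Samelson map: a map `S : ΩX ∧ ΩX → ΩX` whose composite with the quotient map
`ΩX × ΩX → ΩX ∧ ΩX` is homotopic to the commutator map. -/
def IsSamelsonMap (S : PointedMap (smash (loop X) (loop X)) (loop X)) : Prop :=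
  (S.comp (smashQuot (loop X) (loop X))).Homotopic (commutator X)

end PointedMap

open PointedMap

namespace HomotopyClass

variable {A A' B B' X : PointedSpace.{u}}

/-- The adjunction bijection `ad : [ΣA, X] → [A, ΩX]`. -/
def ad : HomotopyClass (susp A) X → HomotopyClass A (loop X) :=
  Quotient.map PointedMap.ad fun _ _ h => PointedMap.Homotopic.ad h

/-- The inverse of `ad`. -/
def adInv : HomotopyClass A (loop X) → HomotopyClass (susp A) X :=
  Quotient.map PointedMap.adInv fun _ _ h => PointedMap.Homotopic.adInv h

/-- The smash product of homotopy classes. -/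
def smashMap : HomotopyClass A A' → HomotopyClass B B' →
    HomotopyClass (smash A B) (smash A' B') :=
  Quotient.map₂ PointedMap.smashMap fun _ _ h _ _ k => PointedMap.Homotopic.smashMap h k

/-- The generalized Whitehead product `[α, β] = ad⁻¹ (S ∘ (ad α ∧ ad β))`, formed with the
Samelson map `S`. -/
def whitehead (S : PointedMap (smash (loop X) (loop X)) (loop X))
    (α : HomotopyClass (susp A) X) (β : HomotopyClass (susp B) X) :
    HomotopyClass (susp (smash A B)) X :=
  adInv (push S (smashMap (ad α) (ad β)))

end HomotopyClass

/-- Hurewicz fibrations: the homotopy lifting property with respect to all spaces. -/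
def IsFibration {E B : PointedSpace.{u}} (p : PointedMap E B) : Prop :=
  ∀ (Z : Type u) [TopologicalSpace Z] (H : C(I × Z, B)) (f : C(Z, E)),
    (∀ z, H (0, z) = p.toMap (f z)) →
      ∃ K : C(I × Z, E), (∀ z, K (0, z) = f z) ∧ ∀ q, p.toMap (K q) = H q

/-- `i : F → E` exhibits `F` as the fibre of `p`: it is a pointed homotopy equivalence onto the
fibre of `p` over the base point (for instance a homeomorphism or the identity), followed by the
inclusion of that fibre. -/
def IsFibreInclusion {F E B : PointedSpace.{u}} (i : PointedMap F E) (p : PointedMap E B) : Prop :=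
  ∃ k : PointedMap F (fibre p), k.IsHomotopyEquiv ∧ ∀ x, (k.toMap x).1 = i.toMap x

/-- The relation `h = {f, g}_s` for the generalized brace product of `f : ΣX → B` and
`g : ΣY → F`, that is, `i_* h = [s_* f, i_* g]`. -/
def IsGenBraceProduct {F E B X Y : PointedSpace.{u}} (s : PointedMap B E) (i : PointedMap F E)
    (f : HomotopyClass (susp X) B) (g : HomotopyClass (susp Y) F)
    (h : HomotopyClass (susp (smash X Y)) F) : Prop :=
  ∃ S : PointedMap (smash (loop E) (loop E)) (loop E), S.IsSamelsonMap ∧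
    HomotopyClass.push i h =
      HomotopyClass.whitehead S (HomotopyClass.push s f) (HomotopyClass.push i g)

/-- All generalized brace products on `[ΣX, B] × [ΣY, F]` are zero. -/
def GenBraceVanishes {F E B : PointedSpace.{u}} (s : PointedMap B E) (i : PointedMap F E)
    (X Y : PointedSpace.{u}) : Prop :=
  ∀ (f : HomotopyClass (susp X) B) (g : HomotopyClass (susp Y) F), IsGenBraceProduct s i f g 0

/-- The map `φ_s = Ωs · Ωi : ΩB × ΩF → ΩE`, `(ω, η) ↦ (s ∘ ω) · (i ∘ η)`. -/
noncomputable def splittingMap {F E B : PointedSpace.{u}} (s : PointedMap B E) (i : PointedMap F E) :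
    PointedMap (PointedSpace.prod (loop B) (loop F)) (loop E) where
  toMap := HSpace.hmul.comp (s.loopMap.toMap.prodMap i.loopMap.toMap)
  map_pt := by
    change (show Path E.pt E.pt from s.loopMap.toMap (loop B).pt).trans
      (show Path E.pt E.pt from i.loopMap.toMap (loop F).pt) = Path.refl E.pt
    rw [s.loopMap.map_pt, i.loopMap.map_pt]
    exact Path.refl_trans_refl

/-- H-maps: `f (x · y)` and `f x · f y` are homotopic, as pointed maps of `(x, y)`. The units of
the H-spaces `ΩX` and `ΩX × ΩY` are their base points. -/
def IsHMap {X Y : PointedSpace.{u}} [HSpace X] [HSpace Y] (f : PointedMap X Y) : Prop :=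
  (f.toMap.comp HSpace.hmul).HomotopicRel
    (HSpace.hmul.comp (f.toMap.prodMap f.toMap)) {(X.pt, X.pt)}

/-- H-splittings: H-maps that are homotopy equivalences. -/
def IsHSplitting {X Y : PointedSpace.{u}} [HSpace X] [HSpace Y] (f : PointedMap X Y) : Prop :=
  IsHMap f ∧ f.IsHomotopyEquiv

end Products

/-! Everything is computed in the groups `[A, ΩX]`. The quotient map `X × Y → X ∧ Y` induces an
injection on maps into a loop space (`pull_smashQuot_injective`), and it turns Samelson products
into honest commutators. So a brace product is determined by the commutator of `s_* f` and `i_* g`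
in `[X × Y, ΩE]` (`isGenBraceProduct_iff`).

For a fibration with homotopy section, `1 → [A, ΩF] → [A, ΩE] → [A, ΩB] → 1` is a split exact
sequence of groups (`exists_pushHom_eq`, `pushHom_injective`, `pushHom_comp_section`). The
commutator dies in `[-, ΩB]` because `p ∘ i` is trivial, so it comes from exactly one class in `[-,
ΩF]`. The splitting also makes `φ_s` a homotopy equivalence, with inverse `ω ↦ (pω, r ω)` where `i r
ω = (s p ω)⁻¹ · ω`.

Cancelling in `s b₁ · s b₂ · i c₁ · i c₂ = s b₁ · i c₁ · s b₂ · i c₂` shows that `φ_s` is an H-map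
exactly when `Ωs` and `Ωi` commute over `ΩB × ΩF`. This is the universal case of vanishing brace
products: it implies all others by pullback, and it is itself the case of the adjoints of the
identities of `ΩB` and `ΩF`.

Well-pointedness enters through explicit Strøm structures, which pass to products and loop spaces
and allow homotopies to be made pointed or relative to the wedge. -/

/-! ### Strøm structures and homotopy extension. -/

/-- Compactness of `I` makes the fibrewise supremum continuous and attained. It turns a function
that detects the base point into one that detects constant paths. -/
theorem unitInterval.exists_continuous_max {Z : Type*} [TopologicalSpace Z] {h : I × Z → I}
    (hh : Continuous h) :
    ∃ m : Z → I, Continuous m ∧ (∀ t z, h (t, z) ≤ m z) ∧ ∀ z, ∃ t, h (t, z) = m z := by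
  have hex : ∀ z, ∃ t, IsMaxOn (fun t => (h (t, z) : ℝ)) Set.univ t := fun z => by
    obtain ⟨t, -, ht⟩ := isCompact_univ.exists_isMaxOn (s := (Set.univ : Set I)) ⟨0, trivial⟩
      (f := fun t => (h (t, z) : ℝ)) (by fun_prop)
    exact ⟨t, ht⟩
  choose τ hτ using hex
  have hle : ∀ t z, h (t, z) ≤ h (τ z, z) := fun t z => hτ z (Set.mem_univ t)
  have hs : Continuous fun z => sSup ((fun t => (h (t, z) : ℝ)) '' (Set.univ : Set I)) :=
    isCompact_univ.continuous_sSup (f := fun z (t : I) => (h (t, z) : ℝ)) (by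
      change Continuous fun q : Z × I => (h (q.2, q.1) : ℝ)
      fun_prop)
  refine ⟨fun z => h (τ z, z), continuous_induced_rng.2 ?_, hle, fun z => ⟨_, rfl⟩⟩
  convert hs using 2 with z
  have hg : IsGreatest ((fun t => (h (t, z) : ℝ)) '' (Set.univ : Set I)) (h (τ z, z)) := by
    refine ⟨⟨τ z, trivial, rfl⟩, ?_⟩
    rintro _ ⟨t, -, rfl⟩
    exact hle t z
  exact hg.csSup_eq.symm

/-- A Strøm structure on a pair `(X, A)`: a function that vanishes exactly on `A`, and a
deformation of `X` rel `A` that moves `x` into `A` after time `u x`. -/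
structure StromStructure {X : Type*} [TopologicalSpace X] (A : Set X) where
  u : X → I
  H : I × X → X
  continuous_u : Continuous u
  continuous_H : Continuous H
  H_zero : ∀ x, H (0, x) = x
  H_of_mem : ∀ t, ∀ x ∈ A, H (t, x) = x
  u_eq_zero : ∀ x, u x = 0 ↔ x ∈ A
  H_mem : ∀ t x, u x < t → H (t, x) ∈ A

namespace StromStructure

variable {X Y Z : Type*} [TopologicalSpace X] [TopologicalSpace Y] [TopologicalSpace Z]
  {A : Set X} {B : Set Y}

theorem isClosed (S : StromStructure A) : IsClosed A := by
  have : A = S.u ⁻¹' {0} := Set.ext fun x => (S.u_eq_zero x).symm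
  exact this ▸ isClosed_singleton.preimage S.continuous_u

theorem closure_subset (S : StromStructure A) :
    closure {q : I × X | S.u q.2 < q.1} ⊆ {q | S.H q ∈ A} :=
  closure_minimal (fun q hq => S.H_mem q.1 q.2 hq) (S.isClosed.preimage S.continuous_H)

/-- The boundary case `t = u x` is a limit of later times, and `A` is closed. If `u x = 1` there are
no later times. -/
theorem H_mem_of_le (S : StromStructure A) {t : I} {x : X} (h : S.u x ≤ t) (h1 : S.u x < 1) :
    S.H (t, x) ∈ A := by
  rcases h.lt_or_eq with h | rfl
  · exact S.H_mem _ _ h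
  · have hc : S.u x ∈ closure (Set.Ioi (S.u x)) := by
      rw [closure_Ioi' (a := S.u x) ⟨1, h1⟩]
      exact Set.self_mem_Ici
    have hm : Set.MapsTo (fun t => (t, x)) (Set.Ioi (S.u x)) {q : I × X | S.u q.2 < q.1} :=
      fun t ht => ht
    exact S.closure_subset (hm.closure (by fun_prop) hc)

/-- The homotopy extension property. -/
theorem exists_extension (S : StromStructure A) {f : X → Z} (hf : Continuous f) {g : I × X → Z}
    (hg : ContinuousOn g {q | q.2 ∈ A}) (h0 : ∀ a ∈ A, g (0, a) = f a) :
    ∃ G : I × X → Z, Continuous G ∧ (∀ x, G (0, x) = f x) ∧ ∀ t, ∀ a ∈ A, G (t, a) = g (t, a) := by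
  classical
  have hu := S.continuous_u
  have hH := S.continuous_H
  let d : I × X → I := fun q => Set.projIcc 0 1 zero_le_one ((q.1 : ℝ) - S.u q.2)
  have hd : Continuous d := continuous_projIcc.comp (by fun_prop)
  have hset : {q : I × X | ¬ q.1 ≤ S.u q.2} = {q | S.u q.2 < q.1} := by ext; simp
  -- Until time `u x` the point flows towards `A` under `H`; after that it lies in `A`, and `g` runs
  -- for the remaining time `d = t - u x`. At the interface `d = 0`, where `g` agrees with `f`.
  refine ⟨fun q => if q.1 ≤ S.u q.2 then f (S.H q) else g (d q, S.H q), ?_, fun x => ?_,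
    fun t a ha => ?_⟩
  · refine continuous_if (fun q hq => ?_) (hf.comp hH).continuousOn ?_
    · have h1 : q.1 = S.u q.2 :=
        frontier_le_subset_eq continuous_fst (hu.comp continuous_snd) hq
      have h2 : S.H q ∈ A := S.closure_subset (by
        rw [← hset]
        have := frontier_subset_closure (s := {q : I × X | q.1 ≤ S.u q.2}ᶜ)
        rw [frontier_compl] at this
        exact this hq)
      have h3 : d q = 0 := by simp [d, h1]
      rw [h3, h0 _ h2]
    · rw [hset]
      exact hg.comp (hd.prodMk hH).continuousOn fun q hq => S.closure_subset hq
  · simp [S.H_zero]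
  · have hua := (S.u_eq_zero a).2 ha
    by_cases ht : t = 0
    · simp [ht, S.H_zero, h0 a ha]
    · have : ¬ t ≤ 0 := fun h => ht (le_antisymm h bot_le)
      simp [hua, this, d, S.H_of_mem _ a ha]

/-- The structure on `(T × X, T × A)`. -/
def prodLeft (T : Type*) [TopologicalSpace T] (S : StromStructure A) :
    StromStructure {q : T × X | q.2 ∈ A} where
  u q := S.u q.2
  H q := (q.2.1, S.H (q.1, q.2.2))
  continuous_u := S.continuous_u.comp continuous_snd
  continuous_H := by have := S.continuous_H; fun_prop
  H_zero q := by simp [S.H_zero]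
  H_of_mem t q hq := by simp [S.H_of_mem t q.2 hq]
  u_eq_zero q := S.u_eq_zero q.2
  H_mem t q h := S.H_mem t q.2 h

/-- The structure on `(X × Y, A × Y ∪ X × B)`. -/
def prod (S : StromStructure A) (T : StromStructure B) :
    StromStructure {z : X × Y | z.1 ∈ A ∨ z.2 ∈ B} where
  u z := min (S.u z.1) (T.u z.2)
  -- Each coordinate stops at the time given by the other one's function, so a point with one
  -- coordinate already in its subset does not move. The coordinate with the smaller function value
  -- still reaches its subset.
  H q := (S.H (min q.1 (T.u q.2.2), q.2.1), T.H (min q.1 (S.u q.2.1), q.2.2))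
  continuous_u := by have := S.continuous_u; have := T.continuous_u; fun_prop
  continuous_H := by
    have := S.continuous_u; have := T.continuous_u
    have := S.continuous_H; have := T.continuous_H
    fun_prop
  H_zero z := by
    simp [S.H_zero, T.H_zero]
  H_of_mem t z hz := by
    rcases hz with hz | hz
    · simp [S.H_of_mem _ _ hz, (S.u_eq_zero _).2 hz, T.H_zero]
    · simp [T.H_of_mem _ _ hz, (T.u_eq_zero _).2 hz, S.H_zero]
  u_eq_zero z := by
    change _ ↔ z.1 ∈ A ∨ z.2 ∈ B
    rw [← S.u_eq_zero, ← T.u_eq_zero]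
    exact min_eq_bot
  H_mem t z h := by
    rcases le_total (S.u z.1) (T.u z.2) with hz | hz
    · rw [min_eq_left hz] at h
      exact Or.inl (S.H_mem_of_le (le_min h.le hz) (h.trans_le unitInterval.le_one'))
    · rw [min_eq_right hz] at h
      exact Or.inr (T.H_mem_of_le (le_min h.le hz) (h.trans_le unitInterval.le_one'))

end StromStructure

/-! ### Well-pointed spaces and their loop spaces. -/

namespace PointedSpace

/-- Homotopy extension into `{0} × X ∪ I × {x₀}` gives a retraction `r` of the cylinder. Its
`X`-component is the deformation, and `u x` is the largest displacement `|t - r(t, x)₁|` of the time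
coordinate. If `r (t, x)` lies in `{0} × X` the displacement is `t`, which is impossible for `u x <
t`. -/
theorem WellPointed.nonempty_stromStructure {X : PointedSpace.{u}} (hX : X.WellPointed) :
    Nonempty (StromStructure ({X.pt} : Set X)) := by
  obtain ⟨hcl, hep⟩ := hX
  obtain ⟨r, r0, r1⟩ := hep {q : I × X // q.1 = 0 ∨ q.2 = X.pt}
    ⟨fun x => ⟨(0, x), Or.inl rfl⟩, by fun_prop⟩
    ⟨fun t => ⟨(t, X.pt), Or.inr rfl⟩, by fun_prop⟩ rfl
  have hr1 : Continuous fun q => (r q).1.1 := by fun_prop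
  have hr2 : Continuous fun q => (r q).1.2 := by fun_prop
  let δ : I × X → I := fun q => Set.projIcc 0 1 zero_le_one |(q.1 : ℝ) - (r q).1.1|
  have hδ : Continuous δ := continuous_projIcc.comp (by fun_prop)
  have hδv : ∀ q, (δ q : ℝ) = |(q.1 : ℝ) - (r q).1.1| := fun q => by
    have h1 := q.1.2
    have h2 := (r q).1.1.2
    simp only [δ]
    rw [Set.projIcc_of_mem zero_le_one
      ⟨abs_nonneg _, abs_le.2 ⟨by linarith [h1.1, h2.2], by linarith [h1.2, h2.1]⟩⟩]
  obtain ⟨m, hm, hle, hex⟩ := unitInterval.exists_continuous_max hδ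
  have hmem : ∀ t x, m x < t → (r (t, x)).1.2 = X.pt := fun t x h => by
    refine (r (t, x)).2.resolve_left fun h0 => ?_
    have h1 : (δ (t, x) : ℝ) < t := (hle t x).trans_lt h
    rw [hδv, h0] at h1
    simp [abs_of_nonneg t.2.1] at h1
  have hrpt : ∀ t, r (t, X.pt) = ⟨(t, X.pt), Or.inr rfl⟩ := fun t => r1 t
  have hr0 : ∀ x, r (0, x) = ⟨(0, x), Or.inl rfl⟩ := fun x => r0 x
  refine ⟨⟨m, fun q => (r q).1.2, hm, hr2, fun x => by rw [hr0], ?_, fun x => ⟨fun h => ?_, ?_⟩,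
    hmem⟩⟩
  · rintro t x rfl
    rw [hrpt]
  · have hc : Continuous fun t : I => (r (t, x)).1.2 := by fun_prop
    -- If `u x = 0`, the deformation sits at the base point for all `t > 0`, hence also at `t = 0`,
    -- where it equals `x`.
    have h0 : (0 : I) ∈ closure (Set.Ioi 0) := by
      rw [closure_Ioi' ⟨1, zero_lt_one⟩]
      exact Set.self_mem_Ici
    have hmaps : Set.MapsTo (fun t : I => (r (t, x)).1.2) (Set.Ioi 0) {X.pt} :=
      fun t ht => hmem t x (h ▸ ht)
    have := hmaps.closure hc h0
    rw [hcl.closure_eq] at this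
    simpa only [hr0] using this
  · rintro rfl
    obtain ⟨t, ht⟩ := hex X.pt
    rw [← ht]
    refine Subtype.ext ?_
    rw [hδv, hrpt]
    simp

theorem _root_.StromStructure.wellPointed {X : PointedSpace.{u}}
    (S : StromStructure ({X.pt} : Set X)) : X.WellPointed := by
  refine ⟨S.isClosed, fun Z _ f γ h => ?_⟩
  obtain ⟨G, hG, G0, G1⟩ := S.exists_extension f.continuous (g := fun q => γ q.1)
    (by fun_prop) (by rintro _ rfl; exact h)
  exact ⟨⟨G, hG⟩, G0, fun t => G1 t _ rfl⟩

theorem WellPointed.nonempty_stromStructure_wedgeSet {X Y : PointedSpace.{u}} (hX : X.WellPointed)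
    (hY : Y.WellPointed) : Nonempty (StromStructure (wedgeSet X Y)) := by
  obtain ⟨S⟩ := hX.nonempty_stromStructure
  obtain ⟨T⟩ := hY.nonempty_stromStructure
  exact ⟨S.prod T⟩

/-- Loop spaces of well-pointed spaces are well-pointed. -/
theorem WellPointed.loop {X : PointedSpace.{u}} (hX : X.WellPointed) : X.loop.WellPointed := by
  obtain ⟨S⟩ := hX.nonempty_stromStructure
  have hu := S.continuous_u
  have hH := S.continuous_H
  -- Loops are deformed pointwise; the maximum of `u` along a loop bounds the time after which all
  -- its points have reached the base point.
  obtain ⟨m, hm, hle, hex⟩ := unitInterval.exists_continuous_max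
    (h := fun q : I × Path X.pt X.pt => S.u (q.2 q.1)) (by fun_prop)
  let D : I × Path X.pt X.pt → Path X.pt X.pt := fun q =>
    { toFun := fun t => S.H (q.1, q.2 t)
      continuous_toFun := by fun_prop
      source' := by rw [q.2.source, S.H_of_mem _ _ rfl]
      target' := by rw [q.2.target, S.H_of_mem _ _ rfl] }
  refine StromStructure.wellPointed (X := X.loop) ⟨m, D, hm, Path.continuous_uncurry_iff.1 ?_,
    fun ω => ?_, ?_, fun ω => ⟨fun h => ?_, ?_⟩, fun t ω h => ?_⟩
  · change Continuous fun q : (I × Path X.pt X.pt) × I => S.H (q.1.1, q.1.2 q.2)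
    fun_prop
  · exact Path.ext (funext fun t => S.H_zero _)
  · rintro t _ rfl
    exact Path.ext (funext fun t => S.H_of_mem _ _ rfl)
  · refine Path.ext (funext fun t => (S.u_eq_zero _).1 ?_)
    exact le_antisymm ((hle t ω).trans_eq h) bot_le
  · rintro rfl
    obtain ⟨t, ht⟩ := hex X.loop.pt
    rw [← ht]
    exact (S.u_eq_zero _).2 rfl
  · exact Path.ext (funext fun r => S.H_mem _ _ ((hle r ω).trans_lt h))

end PointedSpace

/-! ### The groups `[A, ΩX]`. -/

section Loops

open PointedSpace

namespace PointedMap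

variable {A A' X Y : PointedSpace.{u}}

protected theorem ext {f g : PointedMap X Y} (h : ∀ x, f.toMap x = g.toMap x) : f = g := by
  obtain ⟨f, hf⟩ := f
  obtain ⟨g, hg⟩ := g
  obtain rfl : f = g := ContinuousMap.ext h
  rfl

theorem Homotopic.precomp {f f' : PointedMap A X} (h : f.Homotopic f') (g : PointedMap A' A) :
    (f.comp g).Homotopic (f'.comp g) := by
  obtain ⟨H, hH, H0, H1, Hpt⟩ := h.exists_family
  refine .of_family (fun q => H (q.1, g.toMap q.2)) (by fun_prop) (fun x => H0 _) (fun x => H1 _)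
    fun t => ?_
  rw [g.map_pt, Hpt]

/-- The loop `f a`. -/
def path (f : PointedMap A (loop X)) (a : A) : Path X.pt X.pt := f.toMap a

theorem continuous_path (f : PointedMap A (loop X)) : Continuous f.path := f.toMap.continuous

theorem path_pt (f : PointedMap A (loop X)) : f.path A.pt = Path.refl X.pt := f.map_pt

/-- The pointed map given by a continuous family of loops. -/
def ofPath (γ : A → Path X.pt X.pt) (hγ : Continuous γ) (h : γ A.pt = Path.refl X.pt) :
    PointedMap A (loop X) :=
  ⟨⟨γ, hγ⟩, h⟩

/-- Pointed homotopies of maps into a loop space from continuous families of loops. -/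
theorem Homotopic.of_path {f g : PointedMap A (loop X)} (H : I × A → Path X.pt X.pt)
    (hH : Continuous H) (h0 : ∀ a, H (0, a) = f.path a) (h1 : ∀ a, H (1, a) = g.path a)
    (hpt : ∀ t, H (t, A.pt) = Path.refl X.pt) : f.Homotopic g :=
  .of_family (Y := loop X) H hH h0 h1 hpt

theorem Homotopic.exists_path {f g : PointedMap A (loop X)} (h : f.Homotopic g) :
    ∃ H : I × A → Path X.pt X.pt, Continuous H ∧ (∀ a, H (0, a) = f.path a) ∧
      (∀ a, H (1, a) = g.path a) ∧ ∀ t, H (t, A.pt) = Path.refl X.pt :=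
  h.exists_family

/-- Pointwise concatenation. -/
noncomputable def mul (f g : PointedMap A (loop X)) : PointedMap A (loop X) :=
  ofPath (fun a => (f.path a).trans (g.path a)) (f.continuous_path.path_trans g.continuous_path)
    (by rw [path_pt, path_pt, Path.refl_trans_refl])

/-- Pointwise inversion. -/
def inv (f : PointedMap A (loop X)) : PointedMap A (loop X) :=
  ofPath (fun a => (f.path a).symm) (Path.continuous_symm.comp f.continuous_path)
    (by rw [path_pt, Path.refl_symm])

theorem Homotopic.mul {f f' g g' : PointedMap A (loop X)} (hf : f.Homotopic f')
    (hg : g.Homotopic g') : (f.mul g).Homotopic (f'.mul g') := by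
  obtain ⟨H, hH, H0, H1, Hpt⟩ := hf.exists_path
  obtain ⟨K, hK, K0, K1, Kpt⟩ := hg.exists_path
  refine .of_path (fun q => (H q).trans (K q)) (hH.path_trans hK) (fun a => ?_) (fun a => ?_)
    fun t => ?_
  · rw [H0, K0]; rfl
  · rw [H1, K1]; rfl
  · rw [Hpt, Kpt, Path.refl_trans_refl]

theorem Homotopic.inv {f f' : PointedMap A (loop X)} (hf : f.Homotopic f') :
    f.inv.Homotopic f'.inv := by
  obtain ⟨H, hH, H0, H1, Hpt⟩ := hf.exists_path
  refine .of_path (fun q => (H q).symm) (Path.continuous_symm.comp hH) (fun a => ?_) (fun a => ?_)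
    fun t => ?_
  · rw [H0]; rfl
  · rw [H1]; rfl
  · rw [Hpt, Path.refl_symm]

theorem const_mul_homotopic (f : PointedMap A (loop X)) :
    ((PointedMap.const A (loop X)).mul f).Homotopic f := by
  have hf := f.continuous_path
  refine .of_path (fun q => Path.delayReflLeft q.1 (f.path q.2))
    (Path.continuous_delayReflLeft.comp (continuous_fst.prodMk (hf.comp continuous_snd)))
    (fun a => Path.delayReflLeft_zero _)
    (fun a => Path.delayReflLeft_one _) fun t => ?_
  rw [path_pt]
  rfl

theorem mul_const_homotopic (f : PointedMap A (loop X)) :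
    (f.mul (PointedMap.const A (loop X))).Homotopic f := by
  have hf := f.continuous_path
  refine .of_path (fun q => Path.delayReflRight q.1 (f.path q.2))
    (Path.continuous_delayReflRight.comp (continuous_fst.prodMk (hf.comp continuous_snd)))
    (fun a => Path.delayReflRight_zero _)
    (fun a => Path.delayReflRight_one _) fun t => ?_
  rw [path_pt]
  rfl

theorem inv_mul_homotopic (f : PointedMap A (loop X)) :
    (f.inv.mul f).Homotopic (PointedMap.const A (loop X)) := by
  have hf := f.continuous_path
  refine .symm (Homotopic.of_path (f := PointedMap.const A (loop X)) (g := f.inv.mul f)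
    (fun q => (Path.Homotopy.reflSymmTrans (f.path q.2)).eval q.1)
    (Path.continuous_uncurry_iff.1 ?_) (fun a => Path.Homotopy.eval_zero _)
    (fun a => Path.Homotopy.eval_one _) fun t => ?_)
  · change Continuous fun q : (I × A) × I =>
      (f.path q.1.2).symm ⟨Path.Homotopy.reflTransSymmAux (q.1.1, q.2), _⟩
    simp only [Path.symm_apply]
    fun_prop
  · rw [path_pt]
    rfl

/-- The linear homotopy from the identity to `τ` does not depend on the loop, so it is continuous in
families. Associativity of concatenation is an instance. -/
theorem homotopic_reparam (f g : PointedMap A (loop X)) {τ : I → I} (hτ : Continuous τ)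
    (h0 : τ 0 = 0) (h1 : τ 1 = 1) (hg : ∀ a, g.path a = (f.path a).reparam τ hτ h0 h1) :
    f.Homotopic g := by
  have hf := f.continuous_path
  refine .of_path (fun q => (Path.Homotopy.reparam (f.path q.2) τ hτ h0 h1).eval q.1)
    (Path.continuous_uncurry_iff.1 ?_) (fun a => Path.Homotopy.eval_zero _)
    (fun a => (Path.Homotopy.eval_one _).trans (hg a).symm) fun t => ?_
  · change Continuous fun q : (I × A) × I =>
      f.path q.1.2 ⟨unitInterval.symm q.1.1 * q.2 + q.1.1 * τ q.2, _⟩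
    fun_prop
  · rw [path_pt]
    rfl

theorem mul_assoc_homotopic (f g h : PointedMap A (loop X)) :
    ((f.mul g).mul h).Homotopic (f.mul (g.mul h)) :=
  (homotopic_reparam (f.mul (g.mul h)) ((f.mul g).mul h) _ _ _ fun _ =>
    Path.Homotopy.trans_assoc_reparam _ _ _).symm

theorem loopMap_comp_mul (p : PointedMap X Y) (f g : PointedMap A (loop X)) :
    p.loopMap.comp (f.mul g) = (p.loopMap.comp f).mul (p.loopMap.comp g) := by
  refine PointedMap.ext fun a => ?_
  have h := p.map_pt.symm
  change (Path.map ((f.path a).trans (g.path a)) _).cast h h =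
    ((Path.map (f.path a) _).cast h h).trans ((Path.map (g.path a) _).cast h h)
  rw [Path.map_trans, Path.cast_trans]

/-- The inclusion of the first factor. -/
def inl (X Y : PointedSpace.{u}) : PointedMap X (PointedSpace.prod X Y) :=
  ⟨⟨fun x => (x, Y.pt), by fun_prop⟩, rfl⟩

/-- The inclusion of the second factor. -/
def inr (X Y : PointedSpace.{u}) : PointedMap Y (PointedSpace.prod X Y) :=
  ⟨⟨fun y => (X.pt, y), by fun_prop⟩, rfl⟩

/-- The first projection. -/
def fst (X Y : PointedSpace.{u}) : PointedMap (PointedSpace.prod X Y) X := ⟨ContinuousMap.fst, rfl⟩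

/-- The second projection. -/
def snd (X Y : PointedSpace.{u}) : PointedMap (PointedSpace.prod X Y) Y := ⟨ContinuousMap.snd, rfl⟩

/-- The map into a product with the given components. -/
def pair (f : PointedMap A X) (g : PointedMap A Y) : PointedMap A (PointedSpace.prod X Y) :=
  ⟨f.toMap.prodMk g.toMap, Prod.ext f.map_pt g.map_pt⟩

theorem Homotopic.pair {f f' : PointedMap A X} {g g' : PointedMap A Y} (hf : f.Homotopic f')
    (hg : g.Homotopic g') : (f.pair g).Homotopic (f'.pair g') := by
  obtain ⟨H, hH, H0, H1, Hpt⟩ := hf.exists_family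
  obtain ⟨K, hK, K0, K1, Kpt⟩ := hg.exists_family
  exact .of_family (Y := PointedSpace.prod X Y) (fun q => (H q, K q)) (hH.prodMk hK)
    (fun x => Prod.ext (H0 x) (K0 x)) (fun x => Prod.ext (H1 x) (K1 x))
    fun t => Prod.ext (Hpt t) (Kpt t)

end PointedMap

namespace HomotopyClass

open PointedMap

variable {A A' X Y Z : PointedSpace.{u}}

theorem mk_eq {f g : PointedMap A X} : mk f = mk g ↔ f.Homotopic g := Quotient.eq

theorem exists_mk (a : HomotopyClass A X) : ∃ f, mk f = a := Quotient.exists_rep a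

/-- `[A, ΩX]` is a group under concatenation of loops. -/
noncomputable instance : Group (HomotopyClass A (loop X)) where
  mul := Quotient.map₂ PointedMap.mul fun _ _ h _ _ k => Homotopic.mul h k
  one := 0
  inv := Quotient.map PointedMap.inv fun _ _ h => Homotopic.inv h
  mul_assoc := by
    rintro ⟨a⟩ ⟨b⟩ ⟨c⟩
    exact mk_eq.2 (mul_assoc_homotopic a b c)
  one_mul := by
    rintro ⟨a⟩
    exact mk_eq.2 (const_mul_homotopic a)
  mul_one := by
    rintro ⟨a⟩
    exact mk_eq.2 (mul_const_homotopic a)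
  inv_mul_cancel := by
    rintro ⟨a⟩
    exact mk_eq.2 (inv_mul_homotopic a)

theorem mk_mul (f g : PointedMap A (loop X)) : mk (f.mul g) = mk f * mk g := rfl

theorem mk_inv (f : PointedMap A (loop X)) : mk f.inv = (mk f)⁻¹ := rfl

theorem mk_const : mk (PointedMap.const A (loop X)) = 1 := rfl

theorem push_push (h : PointedMap Y Z) (g : PointedMap X Y) (a : HomotopyClass A X) :
    push h (push g a) = push (h.comp g) a := by
  obtain ⟨f, rfl⟩ := exists_mk a
  rfl

theorem push_id (a : HomotopyClass A X) : push (PointedMap.id X) a = a := by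
  obtain ⟨f, rfl⟩ := exists_mk a
  rfl

theorem push_congr {g g' : PointedMap X Y} (h : g.Homotopic g') (a : HomotopyClass A X) :
    push g a = push g' a := by
  obtain ⟨f, rfl⟩ := exists_mk a
  exact mk_eq.2 (h.precomp f)

/-- `k^* : [A, X] → [A', X]`. -/
def pull (k : PointedMap A' A) : HomotopyClass A X → HomotopyClass A' X :=
  Quotient.map (fun f => f.comp k) fun _ _ h => Homotopic.precomp h k

theorem pull_mk (k : PointedMap A' A) (f : PointedMap A X) : pull k (mk f) = mk (f.comp k) := rfl

theorem pull_push (k : PointedMap A' A) (g : PointedMap X Y) (a : HomotopyClass A X) :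
    pull k (push g a) = push g (pull k a) := by
  obtain ⟨f, rfl⟩ := exists_mk a
  rfl

/-- `(Ωp)_*` as a group homomorphism. -/
noncomputable def pushHom (A : PointedSpace.{u}) (p : PointedMap X Y) :
    HomotopyClass A (loop X) →* HomotopyClass A (loop Y) :=
  MonoidHom.mk' (push p.loopMap) (by
    rintro ⟨a⟩ ⟨b⟩
    exact congrArg mk (loopMap_comp_mul p a b))

/-- `k^*` as a group homomorphism. -/
noncomputable def pullHom (X : PointedSpace.{u}) (k : PointedMap A' A) :
    HomotopyClass A (loop X) →* HomotopyClass A' (loop X) :=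
  MonoidHom.mk' (pull k) (by
    rintro ⟨a⟩ ⟨b⟩
    rfl)

theorem pullHom_apply (k : PointedMap A' A) (a : HomotopyClass A (loop X)) :
    pullHom X k a = pull k a := rfl

theorem mk_commutator :
    mk (commutator X) = mk (fst (loop X) (loop X)) * mk (snd (loop X) (loop X)) *
      (mk (fst (loop X) (loop X)))⁻¹ * (mk (snd (loop X) (loop X)))⁻¹ := rfl

/-- The adjunction as a bijection. -/
def adEquiv : HomotopyClass (susp A) X ≃ HomotopyClass A (loop X) where
  toFun := ad
  invFun := adInv
  left_inv := by
    rintro ⟨f⟩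
    exact congrArg mk (adInv_ad f)
  right_inv := by
    rintro ⟨f⟩
    rfl

theorem ad_push (p : PointedMap X Y) (f : HomotopyClass (susp A) X) :
    ad (push p f) = pushHom A p (ad f) := by
  obtain ⟨f, rfl⟩ := exists_mk f
  rfl

end HomotopyClass

end Loops

/-! ### Making a homotopy relative to a cofibration. -/

namespace ContinuousMap.HomotopicRel

variable {P Z : Type*} [TopologicalSpace P] [TopologicalSpace Z] {W : Set P}

/-- A family of maps that is constant on `W` is a homotopy relative to `W`. -/
theorem of_family {f g : C(P, Z)} {z₀ : Z} (H : I × P → Z) (hH : Continuous H)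
    (h0 : ∀ x, H (0, x) = f x) (h1 : ∀ x, H (1, x) = g x) (hW : ∀ t, ∀ x ∈ W, H (t, x) = z₀) :
    f.HomotopicRel g W :=
  ⟨{ toFun := H
     continuous_toFun := hH
     map_zero_left := h0
     map_one_left := h1
     prop' := fun t x hx => (hW t x hx).trans ((hW 0 x hx).symm.trans (h0 x)) }⟩

/-- If a homotopy `h` from `f` to `g` restricts on `W` to a family of loops that is contracted
by `L`, then `f` and `g` are homotopic relative to `W`. -/
theorem of_contraction (S : StromStructure W) {f g : C(P, Z)} {z₀ : Z} {h : I × P → Z}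
    (hh : Continuous h) (h0 : ∀ x, h (0, x) = f x) (h1 : ∀ x, h (1, x) = g x)
    {L : I × (I × P) → Z} (hL : ContinuousOn L {q | q.2.2 ∈ W})
    (L0 : ∀ t, ∀ w ∈ W, L (0, t, w) = h (t, w)) (L1 : ∀ t, ∀ w ∈ W, L (1, t, w) = z₀)
    (Lf : ∀ r, ∀ w ∈ W, L (r, 0, w) = z₀) (Lg : ∀ r, ∀ w ∈ W, L (r, 1, w) = z₀) :
    f.HomotopicRel g W := by
  -- Extending the contraction gives a square of maps with side `h` at `r = 0`. The other three
  -- sides are constant on `W`, and together they lead from `f` to `g`.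
  obtain ⟨M, hM, M0, ML⟩ := (S.prodLeft I).exists_extension hh hL fun q hq => L0 q.1 q.2 hq
  have ML' : ∀ r t, ∀ w ∈ W, M (r, t, w) = L (r, t, w) := fun r t w hw => ML r (t, w) hw
  let e (t : I) : C(P, Z) := ⟨fun x => M (1, t, x), by fun_prop⟩
  have H1 : f.HomotopicRel (e 0) W :=
    of_family (fun q => M (q.1, 0, q.2)) (by fun_prop) (fun x => (M0 _).trans (h0 x))
      (fun x => rfl) fun r w hw => (ML' r 0 w hw).trans (Lf r w hw)
  have H2 : (e 0).HomotopicRel (e 1) W :=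
    of_family (fun q => M (1, q)) (by fun_prop) (fun x => rfl) (fun x => rfl)
      fun t w hw => (ML' 1 t w hw).trans (L1 t w hw)
  have H3 : g.HomotopicRel (e 1) W :=
    of_family (fun q => M (q.1, 1, q.2)) (by fun_prop) (fun x => (M0 _).trans (h1 x))
      (fun x => rfl) fun r w hw => (ML' r 1 w hw).trans (Lg r w hw)
  exact (H1.trans H2).trans H3.symm

end ContinuousMap.HomotopicRel

/-! ### Wedges, smash products and Samelson maps. -/

section Wedge

open PointedSpace

variable {X Y Z : PointedSpace.{u}} {T R : Type*}

open Classical in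
/-- The family of maps `X ∨ Y → R` that is `a` on `X` and `b` on `Y`. -/
noncomputable def wedgeDesc (a : T × X → R) (b : T × Y → R) (q : T × (X × Y)) : R :=
  if q.2.2 = Y.pt then a (q.1, q.2.1) else b (q.1, q.2.2)

theorem wedgeDesc_inl (a : T × X → R) (b : T × Y → R) (t : T) (x : X) :
    wedgeDesc a b (t, (x, Y.pt)) = a (t, x) := if_pos rfl

theorem wedgeDesc_inr {a : T × X → R} {b : T × Y → R} (hab : ∀ t, a (t, X.pt) = b (t, Y.pt))
    (t : T) (y : Y) : wedgeDesc a b (t, (X.pt, y)) = b (t, y) := by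
  by_cases h : y = Y.pt
  · rw [h, wedgeDesc_inl, hab]
  · exact if_neg h

theorem continuousOn_wedgeDesc [TopologicalSpace T] [TopologicalSpace R]
    (hX : IsClosed ({X.pt} : Set X)) (hY : IsClosed ({Y.pt} : Set Y))
    {a : T × X → R} {b : T × Y → R} (ha : Continuous a) (hb : Continuous b)
    (hab : ∀ t, a (t, X.pt) = b (t, Y.pt)) :
    ContinuousOn (wedgeDesc a b) {q | q.2 ∈ wedgeSet X Y} := by
  have h1 : ContinuousOn (wedgeDesc a b) {q : T × (X × Y) | q.2.1 = X.pt} := by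
    refine ContinuousOn.congr (f := fun q => b (q.1, q.2.2)) (by fun_prop) ?_
    rintro ⟨t, x, y⟩ (rfl : x = X.pt)
    exact wedgeDesc_inr hab t y
  have h2 : ContinuousOn (wedgeDesc a b) {q : T × (X × Y) | q.2.2 = Y.pt} := by
    refine ContinuousOn.congr (f := fun q => a (q.1, q.2.1)) (by fun_prop) ?_
    rintro ⟨t, x, y⟩ (rfl : y = Y.pt)
    exact wedgeDesc_inl a b t x
  exact h1.union_of_isClosed h2
    (hX.preimage (f := fun q : T × (X × Y) => q.2.1) (by fun_prop))
    (hY.preimage (f := fun q : T × (X × Y) => q.2.2) (by fun_prop))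

namespace PointedMap

/-- The map out of the smash product given by a map that is constant on the wedge. -/
def smashDesc (f : X × Y → Z) (hf : Continuous f) (h : ∀ z ∈ wedgeSet X Y, f z = Z.pt) :
    PointedMap (smash X Y) Z where
  toMap :=
    { toFun := Quotient.lift f (by
        rintro z w (rfl | ⟨hz, hw⟩)
        · rfl
        · rw [h z hz, h w hw])
      continuous_toFun := hf.quotient_lift _ }
  map_pt := h (X.pt, Y.pt) (Or.inl rfl)

/-- Since `I` is locally compact, `I × (X × Y) → I × (X ∧ Y)` is still a quotient map, and a
homotopy that is constant on the wedge descends. -/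
theorem Homotopic.of_comp_smashQuot {f g : PointedMap (smash X Y) Z}
    (h : (f.comp (smashQuot X Y)).toMap.HomotopicRel (g.comp (smashQuot X Y)).toMap
      (wedgeSet X Y)) : f.Homotopic g := by
  obtain ⟨H⟩ := h
  have key : ∀ t, ∀ z ∈ wedgeSet X Y, H (t, z) = Z.pt := fun t z hz => by
    rw [H.eq_fst t hz]
    exact (congrArg f.toMap (smashMk_eq_pt hz)).trans f.map_pt
  let L : I × smash X Y → Z := fun q =>
    Quotient.lift (fun z : X × Y => H (q.1, z)) (by
      rintro z w (rfl | ⟨hz, hw⟩)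
      · rfl
      · rw [key _ z hz, key _ w hw]) q.2
  refine Homotopic.of_family L ?_ ?_ ?_ fun t => key t (X.pt, Y.pt) (Or.inl rfl)
  · exact isQuotientMap_smashMk.continuous_lift_prod_right H.continuous
  · rintro ⟨z⟩
    exact H.apply_zero z
  · rintro ⟨z⟩
    exact H.apply_one z

/-- A map that is null-homotopic on both axes factors through the smash product. -/
theorem exists_comp_smashQuot_homotopic (hX : X.WellPointed) (hY : Y.WellPointed)
    {c : PointedMap (PointedSpace.prod X Y) Z}
    (h1 : (c.comp (inl X Y)).Homotopic (PointedMap.const X Z))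
    (h2 : (c.comp (inr X Y)).Homotopic (PointedMap.const Y Z)) :
    ∃ S : PointedMap (smash X Y) Z, (S.comp (smashQuot X Y)).Homotopic c := by
  obtain ⟨S⟩ := hX.nonempty_stromStructure_wedgeSet hY
  obtain ⟨N, hN, N0, N1, Npt⟩ := h1.exists_family
  obtain ⟨M, hM, M0, M1, Mpt⟩ := h2.exists_family
  have hab : ∀ t, N (t, X.pt) = M (t, Y.pt) := fun t => by rw [Npt, Mpt]
  obtain ⟨G, hG, G0, GW⟩ := S.exists_extension c.toMap.continuous
    (continuousOn_wedgeDesc hX.1 hY.1 hN hM hab) (by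
      rintro ⟨x, y⟩ (h | h)
      · obtain rfl : x = X.pt := h
        exact (wedgeDesc_inr hab 0 y).trans (M0 y)
      · obtain rfl : y = Y.pt := h
        exact (wedgeDesc_inl N M 0 x).trans (N0 x))
  have hW : ∀ z ∈ wedgeSet X Y, G (1, z) = Z.pt := by
    rintro ⟨x, y⟩ h
    rw [GW 1 _ h]
    rcases h with h | h
    · obtain rfl : x = X.pt := h
      exact (wedgeDesc_inr hab 1 y).trans (M1 y)
    · obtain rfl : y = Y.pt := h
      exact (wedgeDesc_inl N M 1 x).trans (N1 x)
  refine ⟨smashDesc (fun z => G (1, z)) (by fun_prop) hW, .symm ?_⟩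
  refine Homotopic.of_family (X := PointedSpace.prod X Y) G hG G0 (fun z => rfl) fun t => ?_
  change G (t, (X.pt, Y.pt)) = _
  rw [GW t _ (Or.inl rfl), wedgeDesc_inl, Npt]

end PointedMap

namespace HomotopyClass

open PointedMap

/-- The quotient map `X × Y → X ∧ Y` induces an injection on maps into loop spaces. -/
theorem pull_smashQuot_injective (hX : X.WellPointed) (hY : Y.WellPointed) :
    Function.Injective (pull (smashQuot X Y) : HomotopyClass _ (loop Z) → _) := by
  rintro ⟨a⟩ ⟨b⟩ hab
  obtain ⟨S⟩ := hX.nonempty_stromStructure_wedgeSet hY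
  obtain ⟨K, hK, K0, K1, Kpt⟩ := (mk_eq.1 hab).exists_path
  let Kf : I × (X × Y) → Path Z.pt Z.pt := K
  have hKf : Continuous Kf := hK
  let id' := PointedMap.id (loop Z)
  let one := PointedMap.const (loop Z) (loop Z)
  -- Universal contractions of `γ · (γ · 1)⁻¹` and `γ · (1 · γ)⁻¹`, to be applied along the two
  -- axes.
  have n1 : (id'.mul (id'.mul one).inv).Homotopic one := mk_eq.1 (by
    simp only [mk_mul, mk_inv, one, mk_const, mul_one, mul_inv_cancel])
  have n2 : (id'.mul (one.mul id').inv).Homotopic one := mk_eq.1 (by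
    simp only [mk_mul, mk_inv, one, mk_const, one_mul, mul_inv_cancel])
  obtain ⟨N, hN, N0, N1, Npt⟩ := n1.exists_path
  obtain ⟨M, hM, M0, M1, Mpt⟩ := n2.exists_path
  let Nf : I × Path Z.pt Z.pt → Path Z.pt Z.pt := N
  let Mf : I × Path Z.pt Z.pt → Path Z.pt Z.pt := M
  have hNf : Continuous Nf := hN
  have hMf : Continuous Mf := hM
  have Kpt' : ∀ t, Kf (t, (X.pt, Y.pt)) = Path.refl Z.pt := Kpt
  have Npt' : ∀ t, Nf (t, Path.refl Z.pt) = Path.refl Z.pt := Npt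
  have Mpt' : ∀ t, Mf (t, Path.refl Z.pt) = Path.refl Z.pt := Mpt
  let α : (I × I) × X → Path Z.pt Z.pt := fun q => Nf (q.1.1, Kf (q.1.2, (q.2, Y.pt)))
  let β : (I × I) × Y → Path Z.pt Z.pt := fun q => Mf (q.1.1, Kf (q.1.2, (X.pt, q.2)))
  have hα : Continuous α := by fun_prop
  have hβ : Continuous β := by fun_prop
  have hαβ : ∀ t, α (t, X.pt) = β (t, Y.pt) := fun t => by simp only [α, β, Kpt', Npt', Mpt']
  have hend : ∀ (c : PointedMap (smash X Y) (loop Z)) (t : I),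
      (∀ z, Kf (t, z) = (c.comp (smashQuot X Y)).path z) → ∀ z ∈ wedgeSet X Y,
        Kf (t, z) = Path.refl Z.pt := fun c t hc z hz => by
    rw [hc]
    exact (congrArg c.toMap (smashMk_eq_pt hz)).trans c.map_pt
  -- Dividing `K` by its own restrictions to the axes makes it canonically contractible on the
  -- wedge. At `t = 0, 1` these restrictions are constant, so the ends become `a · 1` and `b · 1`.
  let h : I × (X × Y) → Path Z.pt Z.pt := fun q =>
    (Kf q).trans ((Kf (q.1, (q.2.1, Y.pt))).trans (Kf (q.1, (X.pt, q.2.2)))).symm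
  have hh : Continuous h := hKf.path_trans (Path.continuous_symm.comp
    (Continuous.path_trans (f := fun q : I × (X × Y) => Kf (q.1, (q.2.1, Y.pt)))
      (g := fun q : I × (X × Y) => Kf (q.1, (X.pt, q.2.2))) (by fun_prop) (by fun_prop)))
  have hmul : ∀ (c : PointedMap (smash X Y) (loop Z)) (t : I),
      (∀ z, Kf (t, z) = (c.comp (smashQuot X Y)).path z) → ∀ z, h (t, z) =
        ((c.mul (PointedMap.const _ _)).comp (smashQuot X Y)).toMap z := fun c t hc z => by
    change (Kf (t, z)).trans ((Kf (t, (z.1, Y.pt))).trans (Kf (t, (X.pt, z.2)))).symm = _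
    rw [hend c t hc (z.1, Y.pt) (Or.inr rfl), hend c t hc (X.pt, z.2) (Or.inl rfl), hc,
      Path.refl_trans_refl, Path.refl_symm]
    rfl
  have key : (a.mul (PointedMap.const _ _)).Homotopic (b.mul (PointedMap.const _ _)) := by
    refine .of_comp_smashQuot (ContinuousMap.HomotopicRel.of_contraction S
      (z₀ := Path.refl Z.pt) hh (hmul a 0 K0) (hmul b 1 K1)
      (L := fun q => wedgeDesc α β ((q.1, q.2.1), q.2.2)) ?_ ?_ ?_ ?_ ?_)
    · exact (continuousOn_wedgeDesc hX.1 hY.1 hα hβ hαβ).comp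
        (f := fun q : I × (I × (X × Y)) => ((q.1, q.2.1), q.2.2)) (by fun_prop) fun q hq => hq
    · rintro t ⟨x, y⟩ (hz | hz)
      · obtain rfl : x = X.pt := hz
        refine (wedgeDesc_inr hαβ (0, t) y).trans ((M0 _).trans ?_)
        simp only [h, Kpt']
        rfl
      · obtain rfl : y = Y.pt := hz
        refine (wedgeDesc_inl α β (0, t) x).trans ((N0 _).trans ?_)
        simp only [h, Kpt']
        rfl
    · rintro t ⟨x, y⟩ (hz | hz)
      · obtain rfl : x = X.pt := hz
        exact (wedgeDesc_inr hαβ (1, t) y).trans (M1 _)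
      · obtain rfl : y = Y.pt := hz
        exact (wedgeDesc_inl α β (1, t) x).trans (N1 _)
    · rintro r ⟨x, y⟩ (hz | hz)
      · obtain rfl : x = X.pt := hz
        refine (wedgeDesc_inr hαβ (r, 0) y).trans ?_
        simp only [β, hend a 0 K0 (X.pt, y) (Or.inl rfl), Mpt']
      · obtain rfl : y = Y.pt := hz
        refine (wedgeDesc_inl α β (r, 0) x).trans ?_
        simp only [α, hend a 0 K0 (x, Y.pt) (Or.inr rfl), Npt']
    · rintro r ⟨x, y⟩ (hz | hz)
      · obtain rfl : x = X.pt := hz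
        refine (wedgeDesc_inr hαβ (r, 1) y).trans ?_
        simp only [β, hend b 1 K1 (X.pt, y) (Or.inl rfl), Mpt']
      · obtain rfl : y = Y.pt := hz
        refine (wedgeDesc_inl α β (r, 1) x).trans ?_
        simp only [α, hend b 1 K1 (x, Y.pt) (Or.inr rfl), Npt']
  have := mk_eq.2 key
  simp only [mk_mul, mk_const, mul_one] at this
  exact this

end HomotopyClass

open HomotopyClass PointedMap in
/-- Samelson maps of well-pointed spaces exist. -/
theorem exists_isSamelsonMap (hX : X.WellPointed) :
    ∃ S : PointedMap (smash (loop X) (loop X)) (loop X), S.IsSamelsonMap := by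
  refine exists_comp_smashQuot_homotopic hX.loop hX.loop (mk_eq.1 ?_) (mk_eq.1 ?_)
  · rw [← pull_mk, ← pullHom_apply, mk_commutator]
    have : pullHom X (inl (loop X) (loop X)) (mk (snd (loop X) (loop X))) = 1 := rfl
    simp only [map_mul, map_inv, this, mk_const]
    group
  · rw [← pull_mk, ← pullHom_apply, mk_commutator]
    have : pullHom X (inr (loop X) (loop X)) (mk (fst (loop X) (loop X))) = 1 := rfl
    simp only [map_mul, map_inv, this, mk_const]
    group

end Wedge

/-! ### The split exact sequence of a fibration with homotopy section. -/

section Fibration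

open PointedSpace PointedMap

variable {A E B F : PointedSpace.{u}} {p : PointedMap E B}

/-- Fibrations over well-pointed spaces lift homotopies so that the lift is stationary wherever
the homotopy is constant at the base point. -/
theorem IsFibration.exists_lift (hp : IsFibration p) (hB : B.WellPointed) {Z : Type u}
    [TopologicalSpace Z] {H : I × Z → B} (hH : Continuous H) {f : Z → E} (hf : Continuous f)
    (h0 : ∀ z, H (0, z) = p.toMap (f z)) :
    ∃ K : I × Z → E, Continuous K ∧ (∀ z, K (0, z) = f z) ∧ (∀ q, p.toMap (K q) = H q) ∧
      ∀ z, (∀ t, H (t, z) = B.pt) → ∀ t, K (t, z) = f z := by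
  obtain ⟨S⟩ := hB.nonempty_stromStructure
  have hu := S.continuous_u
  obtain ⟨m, hm, hle, hex⟩ := unitInterval.exists_continuous_max
    (h := fun q : I × Z => S.u (H q)) (by fun_prop)
  have hmpt : ∀ z, m z = 0 → ∀ t, H (t, z) = B.pt := fun z hz t =>
    (S.u_eq_zero _).1 (le_antisymm ((hle t z).trans_eq hz) bot_le)
  have hpt : ∀ z, (∀ t, H (t, z) = B.pt) → m z = 0 := fun z hz => by
    obtain ⟨t, ht⟩ := hex z
    rw [← ht, (S.u_eq_zero _).2 (hz t)]
  -- `H'` runs through `H` during `[0, m z]` and then rests. Evaluating its lift at time `t * m z`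
  -- lifts `H`, and does not move at all when `m z = 0`.
  let d : I × Z → I := fun q => Set.projIcc 0 1 zero_le_one ((q.1 : ℝ) / m q.2)
  let H' : I × Z → B := fun q => H (d q, q.2)
  have hd : ∀ t z, m z ≠ 0 → d (t * m z, z) = t := fun t z hz => by
    have hz' : (m z : ℝ) ≠ 0 := unitInterval.coe_ne_zero.2 hz
    simp [d, mul_div_cancel_right₀ _ hz']
  have hH' : Continuous H' := by
    refine continuous_iff_continuousAt.2 fun ⟨t, z⟩ => ?_
    by_cases hz : m z = 0
    · have hHz : H' (t, z) = B.pt := hmpt z hz _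
      intro V hV
      rw [hHz] at hV
      obtain ⟨V', hV', hVo, hVm⟩ := mem_nhds_iff.1 hV
      -- Where `m` vanishes, `d` may be discontinuous, but by compactness `H (t, w)` is close to the
      -- base point for all `t` at once when `w` is near `z`.
      obtain ⟨N₁, N, -, hN, hN₁, hzN, hsub⟩ := generalized_tube_lemma (s := (Set.univ : Set I))
        isCompact_univ (t := {z}) isCompact_singleton (n := H ⁻¹' V') (hVo.preimage hH) (by
          rintro ⟨t, w⟩ ⟨-, rfl⟩
          change H (t, w) ∈ V'
          rwa [hmpt w hz t])
      refine Filter.mem_map.2 (Filter.mem_of_superset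
        ((hN.preimage continuous_snd).mem_nhds (x := (t, z)) (hzN rfl)) fun q hq => hV' ?_)
      exact hsub ⟨hN₁ trivial, hq⟩
    · have hz' : (m z : ℝ) ≠ 0 := unitInterval.coe_ne_zero.2 hz
      have h1 : ContinuousAt d (t, z) :=
        continuous_projIcc.continuousAt.comp (ContinuousAt.div (by fun_prop) (by fun_prop) hz')
      exact hH.continuousAt.comp (h1.prodMk continuousAt_snd)
  obtain ⟨K, K0, K1⟩ := hp Z ⟨H', hH'⟩ ⟨f, hf⟩ fun z => by
    refine Eq.trans ?_ (h0 z)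
    simp [H', d]
  refine ⟨fun q => K (q.1 * m q.2, q.2), by fun_prop, fun z => ?_, fun ⟨t, z⟩ => ?_,
    fun z hz t => ?_⟩
  · simpa using K0 z
  · refine (K1 _).trans ?_
    by_cases hz : m z = 0
    · exact (hmpt z hz _).trans (hmpt z hz _).symm
    · change H (d (t * m z, z), z) = H (t, z)
      rw [hd t z hz]
  · simpa [hpt z hz] using K0 z

/-- The form of the homotopy lifting property that loop maps of fibrations have. -/
theorem IsFibration.exists_lift_path (hp : IsFibration p) (hB : B.WellPointed) {Z : Type u}
    [TopologicalSpace Z] {H : I × Z → Path B.pt B.pt} (hH : Continuous H)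
    {f : Z → Path E.pt E.pt} (hf : Continuous f)
    (h0 : ∀ z t, H (0, z) t = p.toMap (f z t)) :
    ∃ K : I × Z → Path E.pt E.pt, Continuous K ∧ (∀ z, K (0, z) = f z) ∧
      (∀ q t, p.toMap (K q t) = H q t) ∧
      ∀ z, (∀ r, H (r, z) = Path.refl B.pt) → ∀ r, K (r, z) = f z := by
  -- The loop parameter is treated as part of the space; stationarity of the lift over loop
  -- parameters `0` and `1` keeps the lifted paths closed.
  obtain ⟨K, hK, K0, K1, Kpt⟩ := hp.exists_lift hB (Z := Z × I)
    (H := fun q => H (q.1, q.2.1) q.2.2) (by fun_prop) (f := fun q => f q.1 q.2) (by fun_prop)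
    fun q => h0 q.1 q.2
  refine ⟨fun q =>
    { toFun := fun t => K (q.1, (q.2, t))
      continuous_toFun := by fun_prop
      source' := ?_
      target' := ?_ }, Path.continuous_uncurry_iff.1 ?_, fun z => ?_, fun q t => K1 _,
    fun z hz r => ?_⟩
  · rw [Kpt (q.2, 0) fun t => Path.source _, Path.source]
  · rw [Kpt (q.2, 1) fun t => Path.target _, Path.target]
  · change Continuous fun q : (I × Z) × I => K (q.1.1, (q.1.2, q.2))
    fun_prop
  · exact Path.ext (funext fun t => K0 _)
  · refine Path.ext (funext fun t => Kpt (z, t) (fun s => ?_) r)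
    change H (s, z) t = B.pt
    rw [hz s]
    rfl

/-- The inclusion of the fibre over the base point. -/
def fibreIncl (p : PointedMap E B) : PointedMap (fibre p) E := ⟨⟨Subtype.val, by fun_prop⟩, rfl⟩

/-- A loop in the fibre. -/
def fibrePath (p : PointedMap E B) (γ : Path E.pt E.pt) (h : ∀ t, p.toMap (γ t) = B.pt) :
    Path (fibre p).pt (fibre p).pt where
  toFun t := ⟨γ t, h t⟩
  continuous_toFun := γ.continuous.subtype_mk h
  source' := Subtype.ext γ.source
  target' := Subtype.ext γ.target

theorem continuous_fibrePath {T : Type*} [TopologicalSpace T] {γ : T → Path E.pt E.pt}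
    (hγ : Continuous γ) (h : ∀ x t, p.toMap (γ x t) = B.pt) :
    Continuous fun x => fibrePath p (γ x) (h x) := by
  refine Path.continuous_uncurry_iff.1 ?_
  exact Continuous.subtype_mk (p := fun e => p.toMap e = B.pt)
    (f := fun q : T × I => γ q.1 q.2) (by fun_prop) fun q => h q.1 q.2

theorem PointedMap.Homotopic.loopMap {X Y : PointedSpace.{u}} {f f' : PointedMap X Y}
    (h : f.Homotopic f') : f.loopMap.Homotopic f'.loopMap := by
  obtain ⟨H, hH, H0, H1, Hpt⟩ := h.exists_family
  refine .of_path (A := loop X) (fun q : I × Path X.pt X.pt =>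
    { toFun := fun t => H (q.1, q.2 t)
      continuous_toFun := by fun_prop
      source' := by rw [q.2.source, Hpt]
      target' := by rw [q.2.target, Hpt] }) (Path.continuous_uncurry_iff.1 ?_)
    (fun a => Path.ext (funext fun t => H0 _)) (fun a => Path.ext (funext fun t => H1 _))
    fun t => Path.ext (funext fun r => Hpt t)
  change Continuous fun q : (I × Path X.pt X.pt) × I => H (q.1.1, q.1.2 q.2)
  fun_prop

namespace HomotopyClass

/-- Exactness at the total space. -/
theorem exists_pushHom_fibreIncl_eq (hp : IsFibration p) (hB : B.WellPointed)
    {a : HomotopyClass A (loop E)} (ha : pushHom A p a = 1) :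
    ∃ c, pushHom A (fibreIncl p) c = a := by
  obtain ⟨f, rfl⟩ := exists_mk a
  obtain ⟨H, hH, H0, H1, Hpt⟩ := (mk_eq.1 ha).exists_path
  obtain ⟨K, hK, K0, K1, Kpt⟩ := hp.exists_lift_path hB hH f.continuous_path fun z t => by
    rw [H0]
    rfl
  have hK1 : ∀ a t, p.toMap (K (1, a) t) = B.pt := fun a t => by
    rw [K1, H1]
    rfl
  have hKpt : ∀ r, K (r, A.pt) = Path.refl E.pt := fun r => by rw [Kpt _ Hpt, path_pt]
  refine ⟨mk (ofPath (fun a => fibrePath p (K (1, a)) (hK1 a))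
    (continuous_fibrePath (by fun_prop) hK1) ?_), mk_eq.2 (.symm ?_)⟩
  · exact Path.ext (funext fun t => Subtype.ext (congrArg (fun γ : Path E.pt E.pt => γ t) (hKpt 1)))
  · exact Homotopic.of_path K hK K0 (fun a => Path.ext rfl) hKpt

/-- Fibres of fibrations with a homotopy section. -/
theorem pushHom_fibreIncl_injective (hp : IsFibration p) (hB : B.WellPointed) {s : PointedMap B E}
    (hs : (p.comp s).Homotopic (PointedMap.id B)) :
    Function.Injective (pushHom A (fibreIncl p)) := by
  refine (injective_iff_map_eq_one _).2 fun b hb => ?_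
  obtain ⟨b, rfl⟩ := exists_mk b
  obtain ⟨K, hK, K0, K1, Kpt⟩ := (mk_eq.1 hb).exists_path
  -- `μ ω = ω · (s p ω)⁻¹` projects to `ν (p ω)`, and `ν` is null-homotopic. Lifting that
  -- contraction moves `μ` into loops of the fibre, so a null-homotopy `K` in `ΩE` is carried to one
  -- in the fibre's loop space.
  let μ := (PointedMap.id (loop E)).mul (s.loopMap.comp p.loopMap).inv
  let ν := (PointedMap.id (loop B)).mul (p.loopMap.comp s.loopMap).inv
  have hν : ν.Homotopic (PointedMap.const _ _) := mk_eq.1 (by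
    have h : mk (p.loopMap.comp s.loopMap) = mk (PointedMap.id (loop B)) := mk_eq.2 hs.loopMap
    rw [mk_mul, mk_inv, h, mul_inv_cancel, mk_const])
  have hμν : ∀ ω : Path E.pt E.pt, ∀ t,
      ν.path (p.loopMap.path ω) t = p.toMap (μ.path ω t) := fun ω t => by
    have h : p.loopMap.comp μ = ν.comp p.loopMap := loopMap_comp_mul _ _ _
    exact congrArg (fun k : PointedMap (loop E) (loop B) => k.path ω t) h.symm
  obtain ⟨N, hN, N0, N1, Npt⟩ := hν.exists_path
  have hμ := μ.continuous_path
  have hpl := p.loopMap.continuous_path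
  have hμK : Continuous fun z : I × A => μ.path (K z) := hμ.comp hK
  have hNK : Continuous fun q : I × (I × A) => N (q.1, p.loopMap.path (K q.2)) :=
    hN.comp (continuous_fst.prodMk (hpl.comp (hK.comp continuous_snd)))
  obtain ⟨M, hM, M0, M1, Mpt⟩ := hp.exists_lift_path hB hNK hμK fun z t =>
    (congrArg (fun γ : Path B.pt B.pt => γ t) (N0 (p.loopMap.path (K z)))).trans (hμν _ _)
  have hrefl : ∀ z, p.loopMap.path (K z) = Path.refl B.pt → M (1, z) = μ.path (K z) :=
    fun z hz => Mpt z (fun r => by rw [hz]; exact Npt r) 1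
  have hM1 : ∀ z t, p.toMap (M (1, z) t) = B.pt := fun z t =>
    (M1 _ t).trans (congrArg (fun γ : Path B.pt B.pt => γ t) (N1 (p.loopMap.path (K z))))
  have hKr : ∀ z, K z = Path.refl E.pt → M (1, z) = Path.refl E.pt := fun z hz => by
    rw [hrefl z (by rw [hz]; exact p.loopMap.map_pt), hz]
    exact μ.path_pt
  -- On loops of the fibre `μ` is `ω ↦ ω · 1` and the lift is stationary, so the new homotopy starts
  -- at `b · 1`.
  have key : (b.mul (PointedMap.const _ _)).Homotopic (PointedMap.const _ _) := by
    refine .of_path (fun z => fibrePath p (M (1, z)) (hM1 z))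
      (continuous_fibrePath (by fun_prop) hM1) (fun a => ?_) (fun a => ?_) (fun t => ?_)
    · have h1 : p.loopMap.path (K (0, a)) = Path.refl B.pt := by
        rw [K0]
        exact Path.ext (funext fun t => ((b.path a) t).2)
      have h2 : M (1, (0, a)) =
          ((fibreIncl p).loopMap.comp (b.mul (PointedMap.const _ _))).path a := by
        rw [hrefl _ h1, loopMap_comp_mul]
        change (K (0, a)).trans (s.loopMap.path (p.loopMap.path (K (0, a)))).symm = _
        have h3 : s.loopMap.path (Path.refl B.pt) = Path.refl E.pt := s.loopMap.map_pt
        rw [h1, h3, K0]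
        rfl
      refine Path.ext (funext fun t => Subtype.ext ?_)
      exact congrArg (fun γ : Path E.pt E.pt => γ t) h2
    · refine Path.ext (funext fun t => Subtype.ext ?_)
      exact congrArg (fun γ : Path E.pt E.pt => γ t) (hKr (1, a) (K1 a))
    · refine Path.ext (funext fun r => Subtype.ext ?_)
      exact congrArg (fun γ : Path E.pt E.pt => γ r) (hKr (t, A.pt) (Kpt t))
  have := mk_eq.2 key
  simpa only [mk_mul, mk_const, mul_one] using this

theorem pushHom_bijective {X Y : PointedSpace.{u}} {k : PointedMap X Y} (hk : k.IsHomotopyEquiv) :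
    Function.Bijective (pushHom A k) := by
  obtain ⟨l, hl, hr⟩ := hk
  refine Function.bijective_iff_has_inverse.2 ⟨pushHom A l, fun a => ?_, fun a => ?_⟩
  · exact (push_push _ _ _).trans ((push_congr hl.loopMap a).trans (push_id a))
  · exact (push_push _ _ _).trans ((push_congr hr.loopMap a).trans (push_id a))

theorem pushHom_eq_of_isFibreInclusion {i : PointedMap F E} {k : PointedMap F (fibre p)}
    (hk : ∀ x, (k.toMap x).1 = i.toMap x) (a : HomotopyClass A (loop F)) :
    pushHom A i a = pushHom A (fibreIncl p) (pushHom A k a) := by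
  obtain rfl : (fibreIncl p).comp k = i := PointedMap.ext hk
  exact (push_push (fibreIncl p).loopMap k.loopMap a).symm

variable {i : PointedMap F E} {s : PointedMap B E}

theorem exists_pushHom_eq (hp : IsFibration p) (hB : B.WellPointed) (hi : IsFibreInclusion i p)
    {a : HomotopyClass A (loop E)} (ha : pushHom A p a = 1) : ∃ c, pushHom A i c = a := by
  obtain ⟨k, hk, hki⟩ := hi
  obtain ⟨c, hc⟩ := exists_pushHom_fibreIncl_eq hp hB ha
  obtain ⟨d, rfl⟩ := (pushHom_bijective hk).2 c
  exact ⟨d, (pushHom_eq_of_isFibreInclusion hki d).trans hc⟩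

theorem pushHom_injective (hp : IsFibration p) (hB : B.WellPointed) (hi : IsFibreInclusion i p)
    (hs : (p.comp s).Homotopic (PointedMap.id B)) : Function.Injective (pushHom A i) := by
  obtain ⟨k, hk, hki⟩ := hi
  have h : ⇑(pushHom A i) = pushHom A (fibreIncl p) ∘ pushHom A k :=
    funext (pushHom_eq_of_isFibreInclusion hki)
  rw [h]
  exact (pushHom_fibreIncl_injective hp hB hs).comp (pushHom_bijective hk).1

theorem pushHom_comp_fibre (hi : IsFibreInclusion i p) (a : HomotopyClass A (loop F)) :
    pushHom A p (pushHom A i a) = 1 := by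
  obtain ⟨k, hk, hki⟩ := hi
  obtain ⟨f, rfl⟩ := exists_mk a
  refine congrArg mk (PointedMap.ext fun x => Path.ext (funext fun t => ?_))
  change p.toMap (i.toMap _) = B.pt
  rw [← hki]
  exact (k.toMap _).2

theorem pushHom_comp_section (hs : (p.comp s).Homotopic (PointedMap.id B))
    (a : HomotopyClass A (loop B)) : pushHom A p (pushHom A s a) = a :=
  (push_push _ _ _).trans ((push_congr hs.loopMap a).trans (push_id a))

end HomotopyClass

end Fibration

/-! ### Brace products, commutators and the splitting map. -/

section Main

open PointedSpace PointedMap HomotopyClass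

variable {X Y E F B : PointedSpace.{u}} {p : PointedMap E B} {i : PointedMap F E}
  {s : PointedMap B E}

namespace HomotopyClass

theorem pull_pushHom {A A' : PointedSpace.{u}} (k : PointedMap A' A) (p : PointedMap X Y)
    (a : HomotopyClass A (loop X)) : pull k (pushHom A p a) = pushHom A' p (pull k a) :=
  pull_push k p.loopMap a

/-- On the product, the Samelson product is the commutator. -/
theorem pull_smashQuot_samelson {S : PointedMap (smash (loop E) (loop E)) (loop E)}
    (hS : S.IsSamelsonMap) (a : HomotopyClass X (loop E)) (b : HomotopyClass Y (loop E)) :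
    pull (smashQuot X Y) (push S (smashMap a b)) =
      pull (fst X Y) a * pull (snd X Y) b * (pull (fst X Y) a)⁻¹ * (pull (snd X Y) b)⁻¹ := by
  obtain ⟨a, rfl⟩ := exists_mk a
  obtain ⟨b, rfl⟩ := exists_mk b
  exact mk_eq.2 (hS.precomp (((a.comp (fst X Y)).pair (b.comp (snd X Y)))))

end HomotopyClass

/-- Adjunction is bijective and pullback along `smashQuot` injective, so nothing is lost on `X × Y`.
There the Samelson map has become a commutator, and its choice no longer matters. -/
theorem isGenBraceProduct_iff (hX : X.WellPointed) (hY : Y.WellPointed) (hE : E.WellPointed)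
    {f : HomotopyClass (susp X) B} {g : HomotopyClass (susp Y) F}
    {h : HomotopyClass (susp (smash X Y)) F} :
    IsGenBraceProduct s i f g h ↔
      pull (smashQuot X Y) (pushHom _ i (ad h)) =
        pull (fst X Y) (pushHom X s (ad f)) * pull (snd X Y) (pushHom Y i (ad g)) *
          (pull (fst X Y) (pushHom X s (ad f)))⁻¹ *
          (pull (snd X Y) (pushHom Y i (ad g)))⁻¹ := by
  have key : ∀ S : PointedMap (smash (loop E) (loop E)) (loop E),
      push i h = whitehead S (push s f) (push i g) ↔
        pushHom _ i (ad h) = push S (smashMap (pushHom X s (ad f)) (pushHom Y i (ad g))) := by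
    intro S
    rw [← ad_push, ← ad_push, ← ad_push]
    exact adEquiv.eq_symm_apply (y := push i h)
  constructor
  · rintro ⟨S, hS, h⟩
    rw [(key S).1 h, pull_smashQuot_samelson hS]
  · intro h
    obtain ⟨S, hS⟩ := exists_isSamelsonMap hE
    refine ⟨S, hS, (key S).2 (pull_smashQuot_injective hX hY ?_)⟩
    rw [h, pull_smashQuot_samelson hS]

/-- The generalized brace product is well defined. -/
theorem existsUnique_isGenBraceProduct (hX : X.WellPointed) (hY : Y.WellPointed)
    (hE : E.WellPointed) (hB : B.WellPointed) (hp : IsFibration p) (hi : IsFibreInclusion i p)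
    (hs : (p.comp s).Homotopic (PointedMap.id B)) (f : HomotopyClass (susp X) B)
    (g : HomotopyClass (susp Y) F) : ∃! h, IsGenBraceProduct s i f g h := by
  obtain ⟨S, hS⟩ := exists_isSamelsonMap hE
  obtain ⟨c, hc⟩ := exists_pushHom_eq hp hB hi
    (a := push S (smashMap (pushHom X s (ad f)) (pushHom Y i (ad g)))) (by
      -- Applying `p_*` makes the factor from `F` trivial, and a commutator with `1` is `1`.
      refine pull_smashQuot_injective hX hY ?_
      rw [pull_pushHom, pull_smashQuot_samelson hS]
      simp only [map_mul, map_inv]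
      rw [← pull_pushHom (snd X Y), pushHom_comp_fibre hi,
        show pull (snd X Y) (1 : HomotopyClass Y (loop B)) = 1 from rfl,
        show pull (smashQuot X Y) (1 : HomotopyClass _ (loop B)) = 1 from rfl]
      group)
  refine ⟨adInv c, (isGenBraceProduct_iff hX hY hE).2 ?_, fun h hh => ?_⟩
  · change pull (smashQuot X Y) (pushHom _ i (adEquiv (adEquiv.symm c))) = _
    rw [Equiv.apply_symm_apply, hc, pull_smashQuot_samelson hS]
  · refine (adEquiv.eq_symm_apply (x := c)).2 (pushHom_injective hp hB hi hs
      (pull_smashQuot_injective hX hY ?_))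
    refine ((isGenBraceProduct_iff hX hY hE).1 hh).trans ?_
    rw [hc, pull_smashQuot_samelson hS]

/-- The commutator of `Ωs` and `Ωi` in the group `[ΩB × ΩF, ΩE]` is trivial. -/
def LoopMapsCommute (s : PointedMap B E) (i : PointedMap F E) : Prop :=
  Commute (mk (s.loopMap.comp (fst (loop B) (loop F))))
    (mk (i.loopMap.comp (snd (loop B) (loop F))))

/-- The adjoints of `f` and `g` form a map `X × Y → ΩB × ΩF`, along which the commutation relation
is pulled back. -/
theorem genBraceVanishes_of_loopMapsCommute (hX : X.WellPointed) (hY : Y.WellPointed)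
    (hE : E.WellPointed) (h : LoopMapsCommute s i) : GenBraceVanishes s i X Y := by
  intro f g
  obtain ⟨f, rfl⟩ := adEquiv.symm.surjective f
  obtain ⟨g, rfl⟩ := adEquiv.symm.surjective g
  obtain ⟨f, rfl⟩ := exists_mk f
  obtain ⟨g, rfl⟩ := exists_mk g
  refine (isGenBraceProduct_iff hX hY hE).2 ?_
  have hc := h.map (pullHom E ((f.comp (fst X Y)).pair (g.comp (snd X Y))))
  have hc' : Commute (pull (fst X Y) (pushHom X s (mk f))) (pull (snd X Y) (pushHom Y i (mk g))) :=
    hc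
  change pull (smashQuot X Y) (pushHom _ i 1) = pull (fst X Y) (pushHom X s (mk f)) *
    pull (snd X Y) (pushHom Y i (mk g)) * (pull (fst X Y) (pushHom X s (mk f)))⁻¹ *
    (pull (snd X Y) (pushHom Y i (mk g)))⁻¹
  rw [hc'.eq, map_one]
  simp only [mul_inv_cancel_right, mul_inv_cancel]
  rfl

/-- The brace product of the adjoints of `k` and `l` is the universal one up to equivalence; pulling
its vanishing back along homotopy inverses removes `k` and `l`. -/
theorem loopMapsCommute_of_genBraceVanishes {k : PointedMap X (loop B)} {l : PointedMap Y (loop F)}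
    (hk : k.IsHomotopyEquiv) (hl : l.IsHomotopyEquiv) (h : GenBraceVanishes s i X Y) :
    LoopMapsCommute s i := by
  obtain ⟨k', -, hk⟩ := hk
  obtain ⟨l', -, hl⟩ := hl
  obtain ⟨S, hS, h⟩ := h (adEquiv.symm (mk k)) (adEquiv.symm (mk l))
  have h1 : push S (smashMap (mk (s.loopMap.comp k)) (mk (i.loopMap.comp l))) = 1 :=
    (adEquiv.symm_apply_eq.1 h.symm).trans ((ad_push i 0).trans (map_one _))
  have h2 := congrArg (fun a => pull ((k'.comp (fst _ _)).pair (l'.comp (snd _ _)))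
    (pull (smashQuot X Y) a)) h1
  have h3 : ∀ a b : HomotopyClass (PointedSpace.prod (loop B) (loop F)) (loop E),
      a * b * a⁻¹ * b⁻¹ = 1 → Commute a b := fun a b hab => by
    have : a * b * (b * a)⁻¹ = 1 := by rw [← hab]; group
    exact mul_inv_eq_one.1 this
  have hs' : mk ((s.loopMap.comp (k.comp k')).comp (fst (loop B) (loop F))) =
      mk (s.loopMap.comp (fst (loop B) (loop F))) := mk_eq.2 ((hk.postcomp _).precomp _)
  have hi' : mk ((i.loopMap.comp (l.comp l')).comp (snd (loop B) (loop F))) =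
      mk (i.loopMap.comp (snd (loop B) (loop F))) := mk_eq.2 ((hl.postcomp _).precomp _)
  refine h3 _ _ ?_
  rw [← hs', ← hi']
  rw [pull_smashQuot_samelson hS] at h2
  exact h2

theorem isHMap_splittingMap_iff : IsHMap (splittingMap s i) ↔ LoopMapsCommute s i := by
  let P := PointedSpace.prod (loop B) (loop F)
  let B₁ : PointedMap (PointedSpace.prod P P) (loop B) := (fst _ _).comp (fst P P)
  let B₂ : PointedMap (PointedSpace.prod P P) (loop B) := (fst _ _).comp (snd P P)
  let C₁ : PointedMap (PointedSpace.prod P P) (loop F) := (snd _ _).comp (fst P P)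
  let C₂ : PointedMap (PointedSpace.prod P P) (loop F) := (snd _ _).comp (snd P P)
  have h1 : IsHMap (splittingMap s i) ↔
      pushHom _ s (mk B₁ * mk B₂) * pushHom _ i (mk C₁ * mk C₂) =
        (pushHom _ s (mk B₁) * pushHom _ i (mk C₁)) * (pushHom _ s (mk B₂) * pushHom _ i (mk C₂)) :=
    (show IsHMap (splittingMap s i) ↔
      ((s.loopMap.comp (B₁.mul B₂)).mul (i.loopMap.comp (C₁.mul C₂))).Homotopic
        (((s.loopMap.comp B₁).mul (i.loopMap.comp C₁)).mul
          ((s.loopMap.comp B₂).mul (i.loopMap.comp C₂))) from Iff.rfl).trans mk_eq.symm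
  have h2 : IsHMap (splittingMap s i) ↔ Commute (pushHom _ s (mk B₂)) (pushHom _ i (mk C₁)) := by
    -- The outer factors `s b₁` and `i c₂` cancel.
    rw [h1, map_mul, map_mul, mul_assoc, mul_assoc, mul_right_inj, ← mul_assoc, ← mul_assoc,
      mul_left_inj]
    rfl
  rw [h2]
  constructor
  · intro h
    -- Pullback along `(b, c) ↦ ((1, c), (b, 1))`, which recovers `b` from `B₂` and `c` from `C₁`.
    exact h.map (pullHom E (((inr (loop B) (loop F)).comp (snd _ _)).pair
      ((inl (loop B) (loop F)).comp (fst _ _))))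
  · intro h
    exact h.map (pullHom E (((fst _ _).comp (snd P P)).pair ((snd _ _).comp (fst P P))))

/-- The map `φ_s` is a homotopy equivalence. -/
theorem isHomotopyEquiv_splittingMap (hB : B.WellPointed) (hp : IsFibration p)
    (hi : IsFibreInclusion i p) (hs : (p.comp s).Homotopic (PointedMap.id B)) :
    (splittingMap s i).IsHomotopyEquiv := by
  let e := mk (PointedMap.id (loop E))
  -- The part of a loop in `E` left after dividing by `s p` is killed by `p`, hence comes from `ΩF`;
  -- it is the second coordinate of the inverse.
  obtain ⟨r, hr⟩ := exists_pushHom_eq hp hB hi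
    (a := (pushHom _ s (pushHom _ p e))⁻¹ * e) (by
      rw [map_mul, map_inv, pushHom_comp_section hs, inv_mul_cancel])
  obtain ⟨r, rfl⟩ := exists_mk r
  let φ := splittingMap s i
  let b := mk (fst (loop B) (loop F))
  let c := mk (snd (loop B) (loop F))
  have hφ : mk φ = pushHom _ s b * pushHom _ i c := rfl
  have hpφ : pushHom _ p (mk φ) = b := by
    rw [hφ, map_mul, pushHom_comp_section hs, pushHom_comp_fibre hi, mul_one]
  refine ⟨p.loopMap.pair r, ?_, mk_eq.1 ?_⟩
  · have h1 : (p.loopMap.comp φ).Homotopic (fst _ _) := mk_eq.1 hpφ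
    -- After `i_*` this reads `(s b)⁻¹ · (s b · i c) = i c`.
    have h2 : (r.comp φ).Homotopic (snd _ _) := mk_eq.1 (pushHom_injective hp hB hi hs (by
      have := congrArg (pullHom E φ) hr
      rw [map_mul, map_inv] at this
      change pushHom _ i (mk (r.comp φ)) =
        (pushHom _ s (pushHom _ p (mk φ)))⁻¹ * mk φ at this
      rw [this, hpφ, hφ, inv_mul_cancel_left]))
    exact h1.pair h2
  · change pushHom _ s (pushHom _ p e) * pushHom _ i (mk r) = e
    rw [hr, mul_inv_cancel_left]

end Main

theorem mainTheorem1 (F E B : PointedSpace.{u})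
    (hF : F.WellPointed) (hE : E.WellPointed) (hB : B.WellPointed)
    (p : PointedMap E B) (hp : IsFibration p)
    (i : PointedMap F E) (hi : IsFibreInclusion i p)
    (s : PointedMap B E) (hs : (p.comp s).Homotopic (PointedMap.id B)) :
    -- the generalized brace product is a well-defined operation
    (∀ X Y : PointedSpace.{u}, X.WellPointed → Y.WellPointed →
      ∀ (f : HomotopyClass X.susp B) (g : HomotopyClass Y.susp F),
        ∃! h : HomotopyClass (X.smash Y).susp F, IsGenBraceProduct s i f g h) ∧
    -- it vanishes for all spaces if and only if `φ_s` is an H-map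
    ((∀ X Y : PointedSpace.{u}, X.WellPointed → Y.WellPointed → GenBraceVanishes s i X Y) ↔
      IsHMap (splittingMap s i)) ∧
    -- `φ_s` is an H-map if and only if it is an H-splitting
    (IsHMap (splittingMap s i) ↔ IsHSplitting (splittingMap s i)) ∧
    -- vanishing for one pair of models of `ΩB` and `ΩF` suffices
    (∀ (X Y : PointedSpace.{u}) (k : PointedMap X B.loop) (l : PointedMap Y F.loop),
      X.WellPointed → Y.WellPointed → k.IsHomotopyEquiv → l.IsHomotopyEquiv →
        GenBraceVanishes s i X Y → IsHMap (splittingMap s i)) := by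
  have commute_of_vanishes : ∀ (X Y : PointedSpace.{u}) (k : PointedMap X B.loop)
      (l : PointedMap Y F.loop), k.IsHomotopyEquiv → l.IsHomotopyEquiv →
        GenBraceVanishes s i X Y → IsHMap (splittingMap s i) := fun X Y k l hk hl h =>
    isHMap_splittingMap_iff.2 (loopMapsCommute_of_genBraceVanishes hk hl h)
  refine ⟨fun X Y hX hY f g => existsUnique_isGenBraceProduct hX hY hE hB hp hi hs f g,
    ⟨fun h => ?_, fun h X Y hX hY =>
      genBraceVanishes_of_loopMapsCommute hX hY hE (isHMap_splittingMap_iff.1 h)⟩,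
    ⟨fun h => ⟨h, isHomotopyEquiv_splittingMap hB hp hi hs⟩, fun h => h.1⟩,
    fun X Y k l _ _ hk hl h => commute_of_vanishes X Y k l hk hl h⟩
  exact commute_of_vanishes B.loop F.loop (PointedMap.id _) (PointedMap.id _)
    ⟨PointedMap.id _, .refl _, .refl _⟩ ⟨PointedMap.id _, .refl _, .refl _⟩
    (h B.loop F.loop hB.loop hF.loop)
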